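/- **Setting.** Let $p_1<p_2$ be real, $\mu\in(0,1)$, and let $\mathcal F v(p)=\int_{\mathbb R}v(x)e^{-ixp}\,dx$ denote the Fourier transform, extended by duality to $\mathcal S'(\mathbb R)$. Let $u_0\in\mathcal S'(\mathbb R)$ be such that $\mathcal F u_0$ is the function vanishing outside $[p_1,p_2]$ with $\mathcal F u_0(p)=(p-p_1)^{\mu-1}\tilde u(p)$ on $(p_1,p_2)$, where $\tilde u\in C^1([p_1,p_2],\mathbb C)$, $\tilde u(p_1)\ne0$ and $\tilde u(p_2)=0$. Let $u:(0,\infty)\times\mathbb R\to\mathbb C$ be the solution of $i\partial_tu+\partial_x^2u=0$, $u(0)=u_0$, that is, $u(t,\cdot)$ is the continuous function representing the tempered distribution $\mathcal F^{-1}(e^{-itp^2}\mathcal Fu_0)$ (it exists). Fix $\varepsilon\in(0,\tfrac12)$, put $T_\varepsilon:=(p_2-p_1)^{-1/\varepsilon}$ and define $$H(t):=\frac{1}{2\sqrt\pi}\,e^{-i\pi/4}\,e^{it(p_1+t^{-\varepsilon})^2}\,\tilde u(p_1+t^{-\varepsilon}),\qquad K_\mu(t,x):=\frac1{2\pi}\,\frac{\Gamma(\mu)}{2^\mu}\,e^{i\pi\mu/2}\,e^{-itp_1^2+ixp_1}\,\tilde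 u(p_1).$$ Let $\delta$ be any number with $\max\{\tfrac12+\varepsilon,\mu\}<\delta<1$, and let $\gamma:=2\delta-1$. Let $S$ be the maximum of $|\tilde u|$ over $[p_1,p_2]$ divided by $2\pi$, let $W$ be the maximum of $S$ and of the maximum of $|\tilde u'|$ over $[p_1,p_2]$ divided by $2\pi$, and let $L:=\frac{1}{1-\gamma}\frac{\sqrt\pi}{2}\kappa^{\gamma}$, where $\kappa$ is the positive root of $\frac{\sqrt\pi}2\kappa^2-\frac12\kappa-\frac{\sqrt\pi}4=0$. For $k=1,\dots,8$ define $(C_k,\alpha_k,\beta_k)$ by | $k$ | $C_k$ | $\alpha_k$ | $\beta_k$ | |---|---|---|---| | 1 | $\frac{2^{2-\mu}}{\mu}(2-\mu)W$ | $2-\mu$ | $1$ | | 2 | $\frac{2^{1-\mu}}{\mu}W$ | $1-\mu$ | $1$ | | 3 | $(1-\mu)\frac{2^{3-\mu}}3S$ | $4-\mu$ | $2$ | | 4 | $L\,2^{2-\mu}(1-\mu)W$ | $1+\gamma-\mu$ | $\delta$ | | 5 | $L\,2^{1-\mu}W$ | $\gamma-\mu$ | $\delta$ | | 6 | $\sqrt\pi\,2^{2-\mu}S$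 | $3-\mu$ | $\frac32$ | | 7 | $L(1-\mu)(p_2-p_1)^{1-\gamma}W$ | $2-\mu$ | $\delta$ | | 8 | $L(p_2-p_1)^{1-\gamma}W$ | $1-\mu$ | $\delta$ | and let $(C_0,\alpha_0,\beta_0):=(\frac{\Gamma(\mu)}{2^\mu}S,\mu,\mu)$ if $\mu>\frac12$ and $(C_0,\alpha_0,\beta_0):=(\sqrt\pi\,S,1-\mu,\frac12)$ if $\mu<\frac12$. All $C_k$ are $\ge0$ and depend neither on $t,x$ nor, other than through $\delta$, on $\varepsilon$. **Theorem.** For all $t>T_\varepsilon$ and $x$ with $\frac xt=2p_1+2t^{-\varepsilon}$: * if $\mu>\frac12$, then $\big|u(t,x)-H(t)\,t^{-\frac12+\varepsilon(1-\mu)}\big|\le\sum_{k=0}^8C_k\,t^{-\beta_k+\varepsilon\alpha_k}$, and $-\beta_k+\varepsilon\alpha_k<-\frac12+\varepsilon(1-\mu)$ for $k=0,\dots,8$; * if $\mu=\frac12$, then $\big|u(t,x)-(K_\mu(t,x)+H(t))\,t^{-\frac12+\frac\varepsilon2}\big|\le\sum_{k=1}^8C_k\,t^{-\beta_k+\varepsilon\alpha_k}$,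 and $-\beta_k+\varepsilon\alpha_k<-\frac12+\frac\varepsilon2$ for $k=1,\dots,8$; * if $\mu<\frac12$, then $\big|u(t,x)-K_\mu(t,x)\,t^{-\mu+\varepsilon\mu}\big|\le\sum_{k=0}^8C_k\,t^{-\beta_k+\varepsilon\alpha_k}$, and $-\beta_k+\varepsilon\alpha_k<-\mu+\varepsilon\mu$ for $k=0,\dots,8$. Consequently the decay rates $t^{e}$ with $e=-\frac12+\varepsilon(1-\mu)$, $-\frac12+\frac\varepsilon2$, $-\mu+\varepsilon\mu$, respectively, are optimal in bounds of $|u|$ on the region $\{(t,x): t>T_\varepsilon,\ 2p_1+2t^{-\varepsilon}\le\frac xt<2p_2\}$: there are $c>0$ and $T$ such that every point of the curve $\frac xt=2p_1+2t^{-\varepsilon}$ with $t>T$ lies in this region and satisfies $|u(t,x)|\ge c\,t^{e}$. -/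

import Mathlib

open Set
open scoped SchwartzMap FourierTransform ContDiff

noncomputable section

namespace SchrodingerBand

/-! ### The Fourier transform with kernel `exp (-i x p)` on Schwartz functions and on tempered
distributions (Mathlib's transform has kernel `exp (-2 π i x p)`) -/

/-- The dilation `φ ↦ φ (· / (2 π))` of Schwartz functions. -/
def dilation : 𝓢(ℝ, ℂ) →L[ℂ] 𝓢(ℝ, ℂ) :=
  SchwartzMap.compCLMOfContinuousLinearEquiv ℂ
    (ContinuousLinearEquiv.unitsEquivAut ℝ
      (Units.mk0 (2 * Real.pi)⁻¹ (inv_ne_zero Real.two_pi_pos.ne')))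

/-- `(F φ)(p) = ∫ φ(x) exp (-i x p) dx`, see `fourierS_apply`. -/
def fourierS : 𝓢(ℝ, ℂ) →L[ℂ] 𝓢(ℝ, ℂ) :=
  dilation ∘L FourierTransform.fourierCLM ℂ 𝓢(ℝ, ℂ)

/-- `(F⁻¹ φ)(x) = (2 π)⁻¹ ∫ φ(p) exp (i x p) dp`, see `fourierInvS_apply`. -/
def fourierInvS : 𝓢(ℝ, ℂ) →L[ℂ] 𝓢(ℝ, ℂ) :=
  ((2 * Real.pi)⁻¹ : ℂ) • (dilation ∘L FourierTransform.fourierInvCLM ℂ 𝓢(ℝ, ℂ))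

theorem fourierS_apply (φ : 𝓢(ℝ, ℂ)) (p : ℝ) :
    fourierS φ p = ∫ x : ℝ, φ x * Complex.exp (-Complex.I * x * p) := by
  change (𝓕 φ : 𝓢(ℝ, ℂ)) (p * (2 * Real.pi)⁻¹) = _
  rw [SchwartzMap.fourier_coe, Real.fourier_real_eq_integral_exp_smul]
  congr 1
  ext x
  rw [smul_eq_mul, mul_comm]
  congr 2
  have := Real.two_pi_pos.ne'
  push_cast
  field_simp

theorem fourierInvS_apply (φ : 𝓢(ℝ, ℂ)) (x : ℝ) :
    fourierInvS φ x
      = (2 * Real.pi : ℂ)⁻¹ * ∫ p : ℝ, φ p * Complex.exp (Complex.I * x * p) := by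
  change ((2 * Real.pi)⁻¹ : ℂ) * (𝓕⁻ φ : 𝓢(ℝ, ℂ)) (x * (2 * Real.pi)⁻¹) = _
  rw [SchwartzMap.fourierInv_coe, Real.fourierInv_eq']
  congr 2
  ext p
  rw [smul_eq_mul, mul_comm]
  congr 2
  have := Real.two_pi_pos.ne'
  simp only [RCLike.inner_apply, conj_trivial]
  push_cast
  field_simp

/-- The Fourier transform of tempered distributions, `⟨F T, φ⟩ = ⟨T, F φ⟩`. -/
def fourierD : 𝓢'(ℝ, ℂ) →L[ℂ] 𝓢'(ℝ, ℂ) :=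
  PointwiseConvergenceCLM.precomp ℂ fourierS

/-- The inverse Fourier transform of tempered distributions, `⟨F⁻¹ T, φ⟩ = ⟨T, F⁻¹ φ⟩`. -/
def fourierInvD : 𝓢'(ℝ, ℂ) →L[ℂ] 𝓢'(ℝ, ℂ) :=
  PointwiseConvergenceCLM.precomp ℂ fourierInvS

/-- The tempered distribution `T` is (integration against) the function `f`. -/
def RepresentedBy (T : 𝓢'(ℝ, ℂ)) (f : ℝ → ℂ) : Prop :=
  ∀ φ : 𝓢(ℝ, ℂ), MeasureTheory.Integrable (fun x => f x * φ x) ∧ T φ = ∫ x : ℝ, f x * φ x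

/-! ### The initial data -/

/-- The function which vanishes outside `(p₁, p₂)` and equals `(p - p₁)^(μ-1) r(p)` inside. -/
def singularAmplitude (p₁ p₂ μ : ℝ) (r : ℝ → ℂ) (p : ℝ) : ℂ :=
  (Ioo p₁ p₂).indicator (fun q => (((q - p₁) ^ (μ - 1) : ℝ) : ℂ) * r q) p

/-- The tempered distribution `u₀` is in the frequency band `[p₁, p₂]`, its Fourier transform having
a singularity of order `μ - 1` at `p₁`, the regular part `r` on `[p₁, p₂]`, and the value zero at
the regular endpoint `p₂`. -/
structure InitialCondition (p₁ p₂ μ : ℝ) (u₀ : 𝓢'(ℝ, ℂ)) (r : ℝ → ℂ) : Prop where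
  mu_mem : μ ∈ Ioo (0 : ℝ) 1
  lt : p₁ < p₂
  contDiffOn : ContDiffOn ℝ 1 r (Icc p₁ p₂)
  left_ne_zero : r p₁ ≠ 0
  right_eq_zero : r p₂ = 0
  fourier_eq : RepresentedBy (fourierD u₀) (singularAmplitude p₁ p₂ μ r)

/-! ### The free Schrödinger equation `i ∂ₜ u + ∂ₓ² u = 0`, `u(0) = u₀` -/

/-- The multiplier `p ↦ exp (-i t p²)`. -/
def propagator (t p : ℝ) : ℂ := Complex.exp (-Complex.I * t * p ^ 2)

/-- The propagator has temperate growth, so that multiplication of tempered distributions by it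
is meaningful. -/
theorem propagator_hasTemperateGrowth (t : ℝ) : (propagator t).HasTemperateGrowth := by
  have h1 : Function.HasTemperateGrowth (fun θ : ℝ => Complex.exp (Complex.I * θ)) := by
    refine ⟨(contDiff_const.mul Complex.ofRealCLM.contDiff).cexp, fun n => ⟨0, 1, fun x => ?_⟩⟩
    rw [norm_iteratedFDeriv_eq_norm_iteratedDeriv]
    have : iteratedDeriv n (fun θ : ℝ => Complex.exp (Complex.I * θ))
        = fun θ : ℝ => Complex.I ^ n * Complex.exp (Complex.I * θ) := by
      induction n with
      | zero => simp
      | succ n ih =>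
        rw [iteratedDeriv_succ, ih]
        ext θ
        have h : HasDerivAt (fun θ : ℝ => Complex.exp (Complex.I * θ))
            (Complex.exp (Complex.I * θ) * (Complex.I * 1)) θ :=
          ((Complex.ofRealCLM.hasDerivAt (x := θ)).const_mul Complex.I).cexp
        rw [(h.const_mul (Complex.I ^ n)).deriv]
        ring
    rw [this]
    simp [mul_comm Complex.I, Complex.norm_exp_ofReal_mul_I]
  have h2 : Function.HasTemperateGrowth (fun p : ℝ => (-t) * p ^ 2) := by fun_prop
  have h3 := h1.comp h2
  have : propagator t
      = (fun θ : ℝ => Complex.exp (Complex.I * θ)) ∘ fun p : ℝ => (-t) * p ^ 2 := by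
    ext p
    simp only [propagator, Function.comp]
    congr 1
    push_cast
    ring
  rw [this]
  exact h3

/-- The solution `u(t) = F⁻¹ (exp (-i t p²) F u₀)` in the space of tempered distributions. -/
def schrodingerFlow (u₀ : 𝓢'(ℝ, ℂ)) (t : ℝ) : 𝓢'(ℝ, ℂ) :=
  fourierInvD (TemperedDistribution.smulLeftCLM ℂ (propagator t) (fourierD u₀))

/-- `u : (0, ∞) × ℝ → ℂ` is the solution with initial datum `u₀`, as a function: for each time
`t > 0` it is continuous in `x` and represents the distribution solution at time `t`. (Such a
function is unique on `(0, ∞) × ℝ`.) -/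
def IsSolution (u₀ : 𝓢'(ℝ, ℂ)) (u : ℝ → ℝ → ℂ) : Prop :=
  ∀ t : ℝ, 0 < t → Continuous (u t) ∧ RepresentedBy (schrodingerFlow u₀ t) (u t)

/-! ### Space-time curve and region -/

/-- The curve `x / t = 2 a + 2 t^(-ε)`, `t > 0`. -/
def curve (ε a : ℝ) : Set (ℝ × ℝ) :=
  {z | 0 < z.1 ∧ z.2 / z.1 = 2 * a + 2 * z.1 ^ (-ε)}

/-- The time `T_ε(a, b) = (b - a)^(-1/ε)`. -/
def threshold (ε a b : ℝ) : ℝ := (b - a) ^ (-(1 / ε))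

/-- The region `2 a + 2 t^(-ε) ≤ x / t < 2 b`, `t > T_ε(a, b)`. -/
def region (ε a b : ℝ) : Set (ℝ × ℝ) :=
  {z | 0 < z.1 ∧ 2 * a + 2 * z.1 ^ (-ε) ≤ z.2 / z.1 ∧ z.2 / z.1 < 2 * b ∧ threshold ε a b < z.1}

/-- On the curve, which lies in the region from some time on, `|u|` is eventually bounded below by
a positive multiple of `t^e`: no upper bound of `|u|` on the region can decay faster than `t^e`. -/
def RateAttained (ε p₁ p₂ : ℝ) (u : ℝ → ℝ → ℂ) (e : ℝ) : Prop :=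
  ∃ c : ℝ, 0 < c ∧ ∃ T : ℝ, ∀ t x : ℝ, (t, x) ∈ curve ε p₁ → T < t →
    (t, x) ∈ region ε p₁ p₂ ∧ c * t ^ e ≤ ‖u t x‖

/-! ### The coefficients of the leading terms -/

/-- `H(t, u₀) = (2 √π)⁻¹ exp (-i π / 4) exp (i t (p₁ + t^(-ε))²) r(p₁ + t^(-ε))`. -/
def coeffH (ε p₁ : ℝ) (r : ℝ → ℂ) (t : ℝ) : ℂ :=
  ((1 / (2 * √Real.pi) : ℝ) : ℂ) * Complex.exp (-Complex.I * (Real.pi / 4 : ℝ))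
    * Complex.exp (Complex.I * ((t * (p₁ + t ^ (-ε)) ^ 2 : ℝ) : ℂ)) * r (p₁ + t ^ (-ε))

/-- `K_μ(t, x, u₀) = (2 π)⁻¹ Γ(μ) 2^(-μ) exp (i π μ / 2) exp (-i t p₁² + i x p₁) r(p₁)`. -/
def coeffK (p₁ μ : ℝ) (r : ℝ → ℂ) (t x : ℝ) : ℂ :=
  ((1 / (2 * Real.pi) * (Real.Gamma μ / 2 ^ μ) : ℝ) : ℂ)
    * Complex.exp (Complex.I * (Real.pi * μ / 2 : ℝ))
    * Complex.exp (Complex.I * ((-t * p₁ ^ 2 + x * p₁ : ℝ) : ℂ)) * r p₁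

/-! ### The constants and the exponents of the remainders

The parameter `δ ∈ (1/2, 1)` is free, and `γ = 2 δ - 1`. -/

/-- `‖v‖_{L^∞(p₁,p₂)}` of a function that is continuous on `[p₁, p₂]`. -/
def supNorm (p₁ p₂ : ℝ) (v : ℝ → ℂ) : ℝ := sSup ((fun p => ‖v p‖) '' Icc p₁ p₂)

/-- `‖v‖_{W^{1,∞}(p₁,p₂)}` of a function that is `C¹` on `[p₁, p₂]`. -/
def sobolevNorm (p₁ p₂ : ℝ) (v : ℝ → ℂ) : ℝ :=
  max (supNorm p₁ p₂ v) (supNorm p₁ p₂ (derivWithin v (Icc p₁ p₂)))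

/-- The positive root of `a K² - b K - c = 0` for `a = √π / 2`, `b = 1 / 2`, `c = √π / 4`. -/
def rootK : ℝ :=
  (1 / 2 + √((1 / 2) ^ 2 + 4 * (√Real.pi / 2) * (√Real.pi / 4))) / (2 * (√Real.pi / 2))

/-- The constant `L_{γ,2} = a K^γ`. -/
def constL (γ : ℝ) : ℝ := √Real.pi / 2 * rootK ^ γ

/-- The exponents of the distance of stationary point and singularity that are common to the
three cases. -/
def alphaCommon (μ δ : ℝ) : Fin 8 → ℝ :=
  ![2 - μ, 1 - μ, 4 - μ, 1 + (2 * δ - 1) - μ, (2 * δ - 1) - μ, 3 - μ, 2 - μ, 1 - μ]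

/-- The exponents of the time that are common to the three cases. -/
def betaCommon (δ : ℝ) : Fin 8 → ℝ :=
  ![1, 1, 2, δ, δ, 3 / 2, δ, δ]

/-- The constants common to the three cases, for an amplitude with regular part `v`. -/
def constCommon (p₁ p₂ μ δ : ℝ) (v : ℝ → ℂ) : Fin 8 → ℝ :=
  let γ := 2 * δ - 1
  let W := sobolevNorm p₁ p₂ v
  let S := supNorm p₁ p₂ v
  let L := constL γ / (1 - γ)
  ![2 ^ (2 - μ) / μ * (2 - μ) * W,
    2 ^ (1 - μ) / μ * W,
    (1 - μ) * (2 ^ (3 - μ) / 3) * S,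
    L * 2 ^ (2 - μ) * (1 - μ) * W,
    L * 2 ^ (1 - μ) * W,
    √Real.pi / 2 ^ (μ - 2) * S,
    L * (1 - μ) * (p₂ - p₁) ^ (1 - γ) * W,
    L * (p₂ - p₁) ^ (1 - γ) * W]

/-- Regular part of the amplitude `(2 π)⁻¹ F u₀`. -/
def scaled (r : ℝ → ℂ) (p : ℝ) : ℂ := ((1 / (2 * Real.pi) : ℝ) : ℂ) * r p

/-- Exponents and constants for `μ > 1/2`. -/
def alphaGt (μ δ : ℝ) : Fin 9 → ℝ := Matrix.vecCons μ (alphaCommon μ δ)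

def betaGt (μ δ : ℝ) : Fin 9 → ℝ := Matrix.vecCons μ (betaCommon δ)

def constGt (p₁ p₂ μ δ : ℝ) (r : ℝ → ℂ) : Fin 9 → ℝ :=
  Matrix.vecCons (Real.Gamma μ / 2 ^ μ * supNorm p₁ p₂ (scaled r))
    (constCommon p₁ p₂ μ δ (scaled r))

/-- Exponents and constants for `μ = 1/2`. -/
def alphaEq (μ δ : ℝ) : Fin 8 → ℝ := alphaCommon μ δ

def betaEq (δ : ℝ) : Fin 8 → ℝ := betaCommon δ

def constEq (p₁ p₂ μ δ : ℝ) (r : ℝ → ℂ) : Fin 8 → ℝ := constCommon p₁ p₂ μ δ (scaled r)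

/-- Exponents and constants for `μ < 1/2`. -/
def alphaLt (μ δ : ℝ) : Fin 9 → ℝ := Matrix.vecCons (1 - μ) (alphaCommon μ δ)

def betaLt (δ : ℝ) : Fin 9 → ℝ := Matrix.vecCons (1 / 2) (betaCommon δ)

def constLt (p₁ p₂ μ δ : ℝ) (r : ℝ → ℂ) : Fin 9 → ℝ :=
  Matrix.vecCons (√Real.pi * supNorm p₁ p₂ (scaled r)) (constCommon p₁ p₂ μ δ (scaled r))

end SchrodingerBand

end

open SchrodingerBand

/-! On the curve the phase `-t p² + x p` is stationary at `p₁ + d` with `d = t^(-ε)`, so the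
stationary point runs into the singularity `p₁`. The substitution `p = p₁ + d q` freezes this
geometry (`wavePacket_singularAmplitude`): `u` becomes `d^μ` times a unimodular factor times an
integral over `[0, B]`, `B = (p₂ - p₁) / d`, with singularity at `q = 0`, stationary point at `q =
1` and large parameter `N = t d² = t^(1 - 2ε)`. The condition `t > T_ε` says exactly that `B > 1`,
and `ε < 1/2` makes `N` grow.

The normalized integral is expanded in `norm_integral_normalized_sub_le` by cutting at `q = 1/2` and
`q = 1` and integrating by parts on each piece against an explicit primitive. Near the singularity
the variable `s = q (2 - q)` makes the phase linear and the primitive is `oscGamma`, an incomplete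
Gamma integral rotated onto a vertical ray; its value at `0` produces the term `K_μ`, of size `d^μ
N^(-μ)`. On the two sides of the stationary point the primitive is `fresnelTail`; the two values at
`0` add up to the term `H`, of size `d^μ N^(-1/2)`. The boundary terms at `q = 1/2` cancel to order
`N⁻¹`, leaving errors of orders `N⁻²` and `N^(-3/2)`, and the one at `B` vanishes because the
regular part vanishes at `p₂`.

The remaining integrals contain derivatives of the amplitude. Beside the singularity they are
`O(N⁻¹)`. Beside the stationary point, interpolating two bounds of the Fresnel tail gives `N^(-δ)
v^(-γ)`, integrable since `γ < 1`. Powers of `d` and `N` then become powers of `t`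
(`sum_constCommon_eq`), and `δ > 1/2 + ε` makes every remainder smaller than the term `H`
(`exponent_common_lt`).

The exponents of `K_μ` and `H` differ by `(1 - 2ε)(1/2 - μ)`, hence the three regimes; for `μ ≠ 1/2`
the weaker term joins the remainder as `k = 0`. Optimality follows because the modulus of the
leading coefficient stays away from zero; for `μ = 1/2` because the limit of `|H|` is `√2` times
`|K_μ|`. -/

namespace SchrodingerBand
open MeasureTheory Filter Topology

/-! ### An oscillatory incomplete Gamma function -/

/-- The integrand `(s + i y)^a exp (-t y)` on the vertical ray starting at `s`. -/
noncomputable def rayIntegrand (a t s y : ℝ) : ℂ :=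
  ((s : ℂ) + y * Complex.I) ^ (a : ℂ) * Real.exp (-t * y)

/-- The Laplace transform `∫ (s + i y)^a exp (-t y) dy` along the vertical ray starting at `s`. -/
noncomputable def rayIntegral (a t s : ℝ) : ℂ := ∫ y in Ioi (0 : ℝ), rayIntegrand a t s y

theorem le_norm_add_mul_I_left (s y : ℝ) :
    s ≤ ‖(s : ℂ) + y * Complex.I‖ := by
  have := Complex.abs_re_le_norm ((s : ℂ) + y * Complex.I)
  exact (le_abs_self s).trans (by simpa using this)

theorem le_norm_add_mul_I_right (s y : ℝ) :
    y ≤ ‖(s : ℂ) + y * Complex.I‖ := by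
  have := Complex.abs_im_le_norm ((s : ℂ) + y * Complex.I)
  exact (le_abs_self y).trans (by simpa using this)

theorem add_mul_I_mem_slitPlane (s : ℝ) {y : ℝ} (hy : 0 < y) :
    (s : ℂ) + y * Complex.I ∈ Complex.slitPlane := by
  right; simpa using hy.ne'

theorem add_mul_I_mem_slitPlane_of_pos {s : ℝ} (y : ℝ) (hs : 0 < s) :
    (s : ℂ) + y * Complex.I ∈ Complex.slitPlane := by
  left; simpa using hs

theorem norm_rayIntegrand (a t s y : ℝ) :
    ‖rayIntegrand a t s y‖ = ‖(s : ℂ) + y * Complex.I‖ ^ a * Real.exp (-t * y) := by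
  rw [rayIntegrand, norm_mul, Complex.norm_cpow_real, Complex.norm_real, Real.norm_eq_abs,
    abs_of_pos (Real.exp_pos _)]

theorem norm_rayIntegrand_le_left {a t s y : ℝ} (ha : a ≤ 0) (hs : 0 < s) :
    ‖rayIntegrand a t s y‖ ≤ s ^ a * Real.exp (-t * y) := by
  rw [norm_rayIntegrand]
  gcongr ?_ * _
  exact Real.rpow_le_rpow_of_nonpos hs (le_norm_add_mul_I_left s y) ha

theorem norm_rayIntegrand_le_right {a t s y : ℝ} (ha : a ≤ 0) (hy : 0 < y) :
    ‖rayIntegrand a t s y‖ ≤ y ^ a * Real.exp (-t * y) := by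
  rw [norm_rayIntegrand]
  gcongr ?_ * _
  exact Real.rpow_le_rpow_of_nonpos hy (le_norm_add_mul_I_right s y) ha

/-- One factor `|s + i y|⁻¹` is spent on `s⁻¹`, the others on `y^a`. The exponent `a - 1` alone
would not be integrable at `y = 0`. -/
theorem norm_rayIntegrand_sub_one_le {a t s y : ℝ} (ha : a ≤ 0) (hs : 0 < s) (hy : 0 < y) :
    ‖rayIntegrand (a - 1) t s y‖ ≤ s⁻¹ * (y ^ a * Real.exp (-t * y)) := by
  have h0 := le_norm_add_mul_I_left s y
  rw [norm_rayIntegrand, Real.rpow_sub_one (hs.trans_le h0).ne', div_eq_inv_mul, mul_assoc]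
  gcongr ?_ * (?_ * _)
  · exact inv_anti₀ hs h0
  · exact Real.rpow_le_rpow_of_nonpos hy (le_norm_add_mul_I_right s y) ha

theorem continuousOn_rayIntegrand (a t s : ℝ) :
    ContinuousOn (rayIntegrand a t s) (Ioi 0) := by
  intro y hy
  refine ContinuousAt.continuousWithinAt ?_
  unfold rayIntegrand
  refine ContinuousAt.mul (ContinuousAt.cpow (by fun_prop) (by fun_prop)
    (add_mul_I_mem_slitPlane s hy)) (by fun_prop)

theorem aestronglyMeasurable_rayIntegrand (a t s : ℝ) :
    AEStronglyMeasurable (rayIntegrand a t s) (volume.restrict (Ioi 0)) :=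
  (continuousOn_rayIntegrand a t s).aestronglyMeasurable measurableSet_Ioi

theorem integrableOn_exp_neg_mul {t : ℝ} (ht : 0 < t) :
    IntegrableOn (fun y : ℝ => Real.exp (-t * y)) (Ioi 0) :=
  integrableOn_exp_mul_Ioi (by linarith) 0

theorem integral_exp_neg_mul {t : ℝ} (ht : 0 < t) :
    ∫ y in Ioi (0 : ℝ), Real.exp (-t * y) = t⁻¹ := by
  rw [integral_exp_mul_Ioi (by linarith)]
  simp [neg_div_neg_eq]

theorem integrableOn_rpow_mul_exp_neg {a t : ℝ} (ha : -1 < a) (ht : 0 < t) :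
    IntegrableOn (fun y : ℝ => y ^ a * Real.exp (-t * y)) (Ioi 0) := by
  simpa using integrableOn_rpow_mul_exp_neg_mul_rpow ha one_pos ht

theorem integral_rpow_mul_exp_neg {μ t : ℝ} (hμ : 0 < μ) (ht : 0 < t) :
    ∫ y in Ioi (0 : ℝ), y ^ (μ - 1) * Real.exp (-t * y) = Real.Gamma μ * t ^ (-μ) := by
  have := Real.integral_rpow_mul_exp_neg_mul_Ioi hμ ht
  simp only [neg_mul]
  rw [this, mul_comm, one_div, Real.inv_rpow ht.le, Real.rpow_neg ht.le]

theorem integrableOn_rayIntegrand {a t s : ℝ} (ha : a ≤ 0) (ht : 0 < t) (hs : 0 < s) :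
    IntegrableOn (rayIntegrand a t s) (Ioi 0) :=
  ((integrableOn_exp_neg_mul ht).const_mul (s ^ a)).mono'
    (aestronglyMeasurable_rayIntegrand a t s)
    (Eventually.of_forall fun _ => norm_rayIntegrand_le_left ha hs)

theorem norm_rayIntegral_le_left {a t s : ℝ} (ha : a ≤ 0) (ht : 0 < t) (hs : 0 < s) :
    ‖rayIntegral a t s‖ ≤ s ^ a * t⁻¹ := by
  rw [← integral_exp_neg_mul ht, ← integral_const_mul]
  exact norm_integral_le_of_norm_le ((integrableOn_exp_neg_mul ht).const_mul (s ^ a))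
    (Eventually.of_forall fun _ => norm_rayIntegrand_le_left ha hs)

theorem norm_rayIntegral_le_right {μ t : ℝ} (hμ : 0 < μ) (hμ1 : μ ≤ 1) (ht : 0 < t) (s : ℝ) :
    ‖rayIntegral (μ - 1) t s‖ ≤ Real.Gamma μ * t ^ (-μ) := by
  rw [← integral_rpow_mul_exp_neg hμ ht]
  exact norm_integral_le_of_norm_le (integrableOn_rpow_mul_exp_neg (by linarith) ht)
    ((ae_restrict_iff' measurableSet_Ioi).2 (Eventually.of_forall fun y hy =>
      norm_rayIntegrand_le_right (by linarith) hy))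

theorem norm_rayIntegral_sub_one_le {μ t s : ℝ} (hμ : 0 < μ) (hμ1 : μ ≤ 1) (ht : 0 < t)
    (hs : 0 < s) :
    ‖rayIntegral (μ - 1 - 1) t s‖ ≤ s⁻¹ * (Real.Gamma μ * t ^ (-μ)) := by
  rw [← integral_rpow_mul_exp_neg hμ ht, ← integral_const_mul]
  exact norm_integral_le_of_norm_le
    ((integrableOn_rpow_mul_exp_neg (by linarith) ht).const_mul _)
    ((ae_restrict_iff' measurableSet_Ioi).2 (Eventually.of_forall fun y hy =>
      norm_rayIntegrand_sub_one_le (by linarith) hs hy))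

theorem hasDerivAt_add_mul_I_cpow_left (a y : ℝ) {s : ℝ} (hs : 0 < s) :
    HasDerivAt (fun s : ℝ => ((s : ℂ) + y * Complex.I) ^ (a : ℂ))
      (a * ((s : ℂ) + y * Complex.I) ^ ((a - 1 : ℝ) : ℂ)) s := by
  have h : HasDerivAt (fun z : ℂ => z + y * Complex.I) 1 (s : ℂ) := (hasDerivAt_id _).add_const _
  have := (h.cpow_const (c := (a : ℂ)) (add_mul_I_mem_slitPlane_of_pos y hs)).comp_ofReal
  simpa using this

theorem hasDerivAt_add_mul_I_cpow_right (a y : ℝ) {s : ℝ} (hs : 0 < s) :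
    HasDerivAt (fun y : ℝ => ((s : ℂ) + y * Complex.I) ^ (a : ℂ))
      (a * ((s : ℂ) + y * Complex.I) ^ ((a - 1 : ℝ) : ℂ) * Complex.I) y := by
  have h : HasDerivAt (fun z : ℂ => (s : ℂ) + z * Complex.I) (1 * Complex.I) (y : ℂ) :=
    ((hasDerivAt_id _).mul_const _).const_add _
  have := (h.cpow_const (c := (a : ℂ)) (add_mul_I_mem_slitPlane_of_pos y hs)).comp_ofReal
  simpa using this

/-- Integration by parts along the ray. -/
theorem mul_rayIntegral_sub_one {a t s : ℝ} (ha : a ≤ 0) (ht : 0 < t) (hs : 0 < s) :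
    (a : ℂ) * rayIntegral (a - 1) t s
      = Complex.I * (s : ℂ) ^ (a : ℂ) - Complex.I * t * rayIntegral a t s := by
  have hexp : ∀ y : ℝ, HasDerivAt (fun y : ℝ => ((Real.exp (-t * y) : ℝ) : ℂ))
      ((Real.exp (-t * y) * -t : ℝ) : ℂ) y := fun y => by
    have := ((hasDerivAt_id y).const_mul (-t)).exp.ofReal_comp
    simpa using this
  have hd : ∀ y ∈ Ioi (0 : ℝ), HasDerivAt (rayIntegrand a t s)
      (Complex.I * a * rayIntegrand (a - 1) t s y - t * rayIntegrand a t s y) y := fun y _ => by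
    refine ((hasDerivAt_add_mul_I_cpow_right a y hs).mul (hexp y)).congr_deriv ?_
    simp only [rayIntegrand]
    push_cast
    ring
  have hi1 := (integrableOn_rayIntegrand (a := a - 1) (by linarith) ht hs).const_mul
    (Complex.I * a)
  have hi2 := (integrableOn_rayIntegrand ha ht hs).const_mul (t : ℂ)
  have hlim : Tendsto (rayIntegrand a t s) atTop (𝓝 0) := by
    refine squeeze_zero_norm (fun y => norm_rayIntegrand_le_left ha hs) ?_
    have : Tendsto (fun y : ℝ => Real.exp (-t * y)) atTop (𝓝 0) :=
      Real.tendsto_exp_atBot.comp (tendsto_id.const_mul_atTop_of_neg (by linarith))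
    simpa using this.const_mul (s ^ a)
  have hc : ContinuousWithinAt (rayIntegrand a t s) (Ici 0) 0 := by
    refine ContinuousAt.continuousWithinAt ?_
    unfold rayIntegrand
    exact ContinuousAt.mul (ContinuousAt.cpow (by fun_prop) (by fun_prop)
      (add_mul_I_mem_slitPlane_of_pos 0 hs)) (by fun_prop)
  have key := integral_Ioi_of_hasDerivAt_of_tendsto hc hd (hi1.sub hi2) hlim
  rw [integral_sub hi1 hi2, integral_const_mul, integral_const_mul] at key
  change Complex.I * a * rayIntegral (a - 1) t s - t * rayIntegral a t s = _ at key
  simp only [rayIntegrand, Complex.ofReal_zero, zero_mul, add_zero, mul_zero, Real.exp_zero,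
    Complex.ofReal_one, mul_one] at key
  have := congrArg (fun z => -Complex.I * z) key
  linear_combination this + a * rayIntegral (a - 1) t s * Complex.I_sq

theorem hasDerivAt_rayIntegral {a t s : ℝ} (ha : a ≤ 0) (ht : 0 < t) (hs : 0 < s) :
    HasDerivAt (rayIntegral a t) (a * rayIntegral (a - 1) t s) s := by
  -- Staying above `s / 2` gives one dominating function for all nearby base points.
  have hpos : ∀ x ∈ Ioi (s / 2), 0 < x := fun x hx => (half_pos hs).trans hx
  have h := hasDerivAt_integral_of_dominated_loc_of_deriv_le
    (μ := volume.restrict (Ioi (0 : ℝ))) (F := rayIntegrand a t)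
    (F' := fun s y => a * rayIntegrand (a - 1) t s y) (x₀ := s)
    (bound := fun y => |a| * ((s / 2) ^ (a - 1) * Real.exp (-t * y)))
    (Ioi_mem_nhds (half_lt_self hs))
    (Eventually.of_forall fun x => aestronglyMeasurable_rayIntegrand a t x)
    (integrableOn_rayIntegrand ha ht hs)
    ((aestronglyMeasurable_rayIntegrand _ t s).const_mul _)
    (Eventually.of_forall fun y x hx => ?_)
    (((integrableOn_exp_neg_mul ht).const_mul _).const_mul _)
    (Eventually.of_forall fun y x hx => ?_)
  · have := h.2
    rw [integral_const_mul] at this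
    exact this
  · rw [norm_mul, Complex.norm_real, Real.norm_eq_abs]
    gcongr
    refine (norm_rayIntegrand_le_left (by linarith) (hpos x hx)).trans ?_
    gcongr ?_ * _
    exact Real.rpow_le_rpow_of_nonpos (half_pos hs) (le_of_lt hx) (by linarith)
  · refine ((hasDerivAt_add_mul_I_cpow_left a y (hpos x hx)).mul_const _).congr_deriv ?_
    simp only [rayIntegrand]
    ring

/-- The dominating function does not depend on `s`, so continuity reaches `s = 0`, where the
integrand is singular. The boundary term at the singularity needs this. -/
theorem continuousOn_rayIntegral {μ t : ℝ} (hμ : 0 < μ) (hμ1 : μ ≤ 1) (ht : 0 < t) :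
    ContinuousOn (rayIntegral (μ - 1) t) (Ici 0) := by
  refine continuousOn_of_dominated (bound := fun y => y ^ (μ - 1) * Real.exp (-t * y))
    (fun s _ => aestronglyMeasurable_rayIntegrand _ t s) (fun s _ => ?_)
    (integrableOn_rpow_mul_exp_neg (by linarith) ht) ?_
  · exact (ae_restrict_iff' measurableSet_Ioi).2 (Eventually.of_forall fun y hy =>
      norm_rayIntegrand_le_right (by linarith) hy)
  · refine (ae_restrict_iff' measurableSet_Ioi).2 (Eventually.of_forall fun y hy s hs => ?_)
    refine ContinuousAt.continuousWithinAt ?_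
    unfold rayIntegrand
    exact ContinuousAt.mul (ContinuousAt.cpow (by fun_prop) (by fun_prop)
      (add_mul_I_mem_slitPlane s hy)) (by fun_prop)

/-- The primitive of `-s^(μ - 1) exp (i t s)` on `(0, ∞)` that vanishes at infinity. -/
noncomputable def oscGamma (μ t s : ℝ) : ℂ :=
  Complex.I * Complex.exp (Complex.I * t * s) * rayIntegral (μ - 1) t s

theorem norm_exp_I_mul_mul (t s : ℝ) : ‖Complex.exp (Complex.I * t * s)‖ = 1 := by
  rw [show Complex.I * t * s = ((t * s : ℝ) : ℂ) * Complex.I by push_cast; ring]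
  exact Complex.norm_exp_ofReal_mul_I _

theorem norm_oscGamma (μ t s : ℝ) : ‖oscGamma μ t s‖ = ‖rayIntegral (μ - 1) t s‖ := by
  rw [oscGamma, norm_mul, norm_mul, norm_exp_I_mul_mul, Complex.norm_I, one_mul, one_mul]

theorem hasDerivAt_exp_I_mul_mul (t s : ℝ) :
    HasDerivAt (fun s : ℝ => Complex.exp (Complex.I * t * s))
      (Complex.exp (Complex.I * t * s) * (Complex.I * t)) s := by
  have : HasDerivAt (fun s : ℝ => Complex.I * t * (s : ℂ)) (Complex.I * t * 1) s :=
    Complex.ofRealCLM.hasDerivAt.const_mul _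
  simpa using this.cexp

/-- Differentiating the exponential and the ray integral gives two multiples of `rayIntegral (μ -
1)`, which cancel by the integration by parts along the ray; only the boundary term survives. -/
theorem hasDerivAt_oscGamma {μ t s : ℝ} (hμ1 : μ ≤ 1) (ht : 0 < t) (hs : 0 < s) :
    HasDerivAt (oscGamma μ t)
      (-(((s ^ (μ - 1) : ℝ) : ℂ) * Complex.exp (Complex.I * t * s))) s := by
  refine (((hasDerivAt_exp_I_mul_mul t s).const_mul Complex.I).mul
    (hasDerivAt_rayIntegral (a := μ - 1) (by linarith) ht hs)).congr_deriv ?_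
  rw [mul_rayIntegral_sub_one (by linarith) ht hs, Complex.ofReal_cpow hs.le]
  linear_combination Complex.exp (Complex.I * t * s) * (s : ℂ) ^ ((μ - 1 : ℝ) : ℂ) * Complex.I_sq

theorem continuousOn_oscGamma {μ t : ℝ} (hμ : 0 < μ) (hμ1 : μ ≤ 1) (ht : 0 < t) :
    ContinuousOn (oscGamma μ t) (Ici 0) :=
  ContinuousOn.mul (by fun_prop) (continuousOn_rayIntegral hμ hμ1 ht)

/-- At `s = 0` the ray is the imaginary axis: `(i y)^(μ - 1)` splits, the `y` part is Euler's
integral, and `i · i^(μ - 1) = exp (i π μ / 2)`. -/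
theorem oscGamma_zero {μ t : ℝ} (hμ : 0 < μ) (ht : 0 < t) :
    oscGamma μ t 0 = ((Real.Gamma μ * t ^ (-μ) : ℝ) : ℂ)
      * Complex.exp (Complex.I * (Real.pi * μ / 2 : ℝ)) := by
  have h : rayIntegral (μ - 1) t 0
      = Complex.I ^ ((μ - 1 : ℝ) : ℂ) * ((Real.Gamma μ * t ^ (-μ) : ℝ) : ℂ) := by
    rw [← integral_rpow_mul_exp_neg hμ ht, ← integral_complex_ofReal, ← integral_const_mul]
    refine setIntegral_congr_fun measurableSet_Ioi fun y hy => ?_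
    have hy' : (0 : ℝ) < y := hy
    have hyI : (y : ℂ) * Complex.I ≠ 0 :=
      mul_ne_zero (by exact_mod_cast hy'.ne') Complex.I_ne_zero
    simp only [rayIntegrand, Complex.ofReal_zero, zero_add]
    rw [Complex.cpow_def_of_ne_zero hyI, Complex.log_ofReal_mul hy' Complex.I_ne_zero, add_mul,
      Complex.exp_add, ← Complex.cpow_def_of_ne_zero Complex.I_ne_zero, Real.rpow_def_of_pos hy']
    push_cast
    ring
  rw [oscGamma, h, Complex.cpow_def_of_ne_zero Complex.I_ne_zero, Complex.log_I]
  have : Complex.exp (Real.pi / 2 * Complex.I * ((μ - 1 : ℝ) : ℂ))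
      = -Complex.I * Complex.exp (Complex.I * (Real.pi * μ / 2 : ℝ)) := by
    rw [← Complex.exp_neg_pi_div_two_mul_I, ← Complex.exp_add]
    congr 1
    push_cast
    ring
  rw [this]
  simp only [Complex.ofReal_zero, mul_zero, Complex.exp_zero]
  linear_combination (-((Real.Gamma μ * t ^ (-μ) : ℝ) : ℂ)
      * Complex.exp (Complex.I * (Real.pi * μ / 2 : ℝ))) * Complex.I_sq

theorem norm_oscGamma_le_left {μ t s : ℝ} (hμ1 : μ ≤ 1) (ht : 0 < t) (hs : 0 < s) :
    ‖oscGamma μ t s‖ ≤ s ^ (μ - 1) * t⁻¹ := by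
  rw [norm_oscGamma]
  exact norm_rayIntegral_le_left (by linarith) ht hs

theorem norm_oscGamma_le_right {μ t : ℝ} (hμ : 0 < μ) (hμ1 : μ ≤ 1) (ht : 0 < t) (s : ℝ) :
    ‖oscGamma μ t s‖ ≤ Real.Gamma μ * t ^ (-μ) := by
  rw [norm_oscGamma]
  exact norm_rayIntegral_le_right hμ hμ1 ht s

/-- A further integration by parts along the ray: its boundary term is the leading term for large
`t`, and the remaining ray integral is the exact error. -/
theorem norm_oscGamma_sub_eq {μ t s : ℝ} (hμ1 : μ ≤ 1) (ht : 0 < t) (hs : 0 < s) :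
    ‖oscGamma μ t s
        - Complex.I * Complex.exp (Complex.I * t * s) * ((s ^ (μ - 1) * t⁻¹ : ℝ) : ℂ)‖
      = (1 - μ) * t⁻¹ * ‖rayIntegral (μ - 1 - 1) t s‖ := by
  have h := mul_rayIntegral_sub_one (a := μ - 1) (by linarith) ht hs
  rw [← Complex.ofReal_cpow hs.le] at h
  have ht' : (t : ℂ) ≠ 0 := by exact_mod_cast ht.ne'
  have : oscGamma μ t s
        - Complex.I * Complex.exp (Complex.I * t * s) * ((s ^ (μ - 1) * t⁻¹ : ℝ) : ℂ)
      = Complex.exp (Complex.I * t * s)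
        * (((1 - μ) * t⁻¹ : ℝ) * rayIntegral (μ - 1 - 1) t s) := by
    have h2 : ((1 - μ : ℝ) : ℂ) * rayIntegral (μ - 1 - 1) t s = -(Complex.I *
        ((s ^ (μ - 1) : ℝ) : ℂ) - Complex.I * t * rayIntegral (μ - 1) t s) := by
      rw [← h]; push_cast; ring
    rw [oscGamma, Complex.ofReal_mul (1 - μ), mul_right_comm _ _ (rayIntegral (μ - 1 - 1) t s), h2]
    push_cast
    field_simp
    ring
  rw [this, norm_mul, norm_exp_I_mul_mul, one_mul, norm_mul, Complex.norm_real, Real.norm_eq_abs,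
    abs_of_nonneg (mul_nonneg (by linarith) (inv_nonneg.2 ht.le))]

theorem norm_oscGamma_sub_le_left {μ t s : ℝ} (hμ1 : μ ≤ 1) (ht : 0 < t) (hs : 0 < s) :
    ‖oscGamma μ t s
        - Complex.I * Complex.exp (Complex.I * t * s) * ((s ^ (μ - 1) * t⁻¹ : ℝ) : ℂ)‖
      ≤ (1 - μ) * t⁻¹ * (s ^ (μ - 1 - 1) * t⁻¹) := by
  rw [norm_oscGamma_sub_eq hμ1 ht hs]
  have : 0 ≤ (1 - μ) * t⁻¹ := mul_nonneg (by linarith) (inv_nonneg.2 ht.le)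
  gcongr
  exact norm_rayIntegral_le_left (by linarith) ht hs

theorem norm_oscGamma_sub_le_right {μ t s : ℝ} (hμ : 0 < μ) (hμ1 : μ ≤ 1) (ht : 0 < t)
    (hs : 0 < s) :
    ‖oscGamma μ t s
        - Complex.I * Complex.exp (Complex.I * t * s) * ((s ^ (μ - 1) * t⁻¹ : ℝ) : ℂ)‖
      ≤ (1 - μ) * t⁻¹ * (s⁻¹ * (Real.Gamma μ * t ^ (-μ))) := by
  rw [norm_oscGamma_sub_eq hμ1 ht hs]
  have : 0 ≤ (1 - μ) * t⁻¹ := mul_nonneg (by linarith) (inv_nonneg.2 ht.le)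
  gcongr
  exact norm_rayIntegral_sub_one_le hμ hμ1 ht hs

/-! ### The tail of the Fresnel integral -/

/-- The tail `∫ exp (-i N z²) dz` over `(v, ∞)`, for `v ≥ 0`. -/
noncomputable def fresnelTail (N v : ℝ) : ℂ :=
  (1 / 2 : ℝ) * (starRingEnd ℂ) (oscGamma (1 / 2) N (v ^ 2))

theorem norm_fresnelTail (N v : ℝ) : ‖fresnelTail N v‖ = 1 / 2 * ‖oscGamma (1 / 2) N (v ^ 2)‖ := by
  rw [fresnelTail, norm_mul, RCLike.norm_conj, Complex.norm_real]
  norm_num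

theorem conj_exp_I_mul (t s : ℝ) :
    (starRingEnd ℂ) (Complex.exp (Complex.I * t * s)) = Complex.exp (-Complex.I * t * s) := by
  rw [← Complex.exp_conj]
  simp

theorem sq_rpow_neg_half {v : ℝ} (hv : 0 < v) : (v ^ 2) ^ ((1 / 2 : ℝ) - 1) = v⁻¹ := by
  rw [← Real.rpow_natCast, ← Real.rpow_mul hv.le, ← Real.rpow_neg_one]
  norm_num

/-- The substitution `σ = z²` turns the tail into half of the integral of `σ^(-1/2) exp (-i N σ)`
from `v²`, the conjugate of an `oscGamma` with `μ = 1/2`. -/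
theorem hasDerivAt_fresnelTail {N v : ℝ} (hN : 0 < N) (hv : 0 < v) :
    HasDerivAt (fresnelTail N) (-Complex.exp (-Complex.I * N * (v ^ 2 : ℝ))) v := by
  have h1 := HasDerivAt.scomp (h := fun v : ℝ => v ^ 2) v
    (hasDerivAt_oscGamma (μ := 1 / 2) (by norm_num) hN (pow_pos hv 2)) (hasDerivAt_pow 2 v)
  have h2 := (h1.star).const_mul (((1 / 2 : ℝ) : ℝ) : ℂ)
  refine h2.congr_deriv ?_
  have hv' : (v : ℂ) ≠ 0 := by exact_mod_cast hv.ne'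
  rw [← starRingEnd_apply, Complex.real_smul, map_mul, map_neg, map_mul, Complex.conj_ofReal,
    Complex.conj_ofReal,
    conj_exp_I_mul, sq_rpow_neg_half hv]
  push_cast
  field_simp

theorem continuous_fresnelTail {N : ℝ} (hN : 0 < N) : Continuous (fresnelTail N) := by
  refine continuous_const.mul (Complex.continuous_conj.comp ?_)
  exact (continuousOn_oscGamma (by norm_num) (by norm_num) hN).comp_continuous (by fun_prop)
    fun v => sq_nonneg v

theorem two_mul_fresnelTail_zero {N : ℝ} (hN : 0 < N) :
    2 * fresnelTail N 0 = ((√Real.pi * N ^ (-(1 / 2) : ℝ) : ℝ) : ℂ)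
      * Complex.exp (-Complex.I * (Real.pi / 4 : ℝ)) := by
  rw [fresnelTail, zero_pow two_ne_zero, oscGamma_zero (by norm_num) hN, map_mul,
    Complex.conj_ofReal, Real.Gamma_one_half_eq, ← Complex.exp_conj, ← mul_assoc, ← mul_assoc]
  congr 2
  · push_cast; ring
  · rw [map_mul, Complex.conj_I, Complex.conj_ofReal]
    push_cast
    ring

theorem norm_fresnelTail_le {N : ℝ} (hN : 0 < N) (v : ℝ) :
    ‖fresnelTail N v‖ ≤ √Real.pi / 2 * N ^ (-(1 / 2) : ℝ) := by
  have := norm_oscGamma_le_right (μ := 1 / 2) (by norm_num) (by norm_num) hN (v ^ 2)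
  rw [norm_fresnelTail]
  rw [Real.Gamma_one_half_eq] at this
  linarith

theorem norm_fresnelTail_le_inv {N v : ℝ} (hN : 0 < N) (hv : 0 < v) :
    ‖fresnelTail N v‖ ≤ 1 / 2 * (v⁻¹ * N⁻¹) := by
  have := norm_oscGamma_le_left (μ := 1 / 2) (by norm_num) hN (pow_pos hv 2)
  rw [norm_fresnelTail]
  rw [sq_rpow_neg_half hv] at this
  linarith

/-- The interpolation below naturally carries `1 / √π`. This comparison allows the larger number `κ`
in its place, as the stated constants require. -/
theorem inv_sqrt_pi_le_rootK : (√Real.pi)⁻¹ ≤ rootK := by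
  have hpi := Real.sqrt_pos.2 Real.pi_pos
  have h : 1 / 2 ≤ √((1 / 2) ^ 2 + 4 * (√Real.pi / 2) * (√Real.pi / 4)) :=
    Real.le_sqrt_of_sq_le (by nlinarith [mul_pos hpi hpi])
  rw [rootK, inv_eq_one_div, mul_div_cancel₀ _ two_ne_zero]
  gcongr
  linarith

theorem rootK_pos : 0 < rootK :=
  (inv_pos.2 (Real.sqrt_pos.2 Real.pi_pos)).trans_le inv_sqrt_pi_le_rootK

theorem constL_pos (γ : ℝ) : 0 < constL γ :=
  mul_pos (half_pos (Real.sqrt_pos.2 Real.pi_pos)) (Real.rpow_pos_of_pos rootK_pos γ)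

/-- Geometric interpolation with weights `1 - γ` and `γ` between the uniform bound of order
`N^(-1/2)` and the decaying bound of order `v⁻¹ N⁻¹`. -/
theorem norm_fresnelTail_le_rpow {N v γ : ℝ} (hN : 0 < N) (hv : 0 < v) (hγ : 0 ≤ γ) (hγ1 : γ ≤ 1) :
    ‖fresnelTail N v‖ ≤ constL γ * N ^ (-((1 + γ) / 2)) * v ^ (-γ) := by
  have hpi := Real.sqrt_pos.2 Real.pi_pos
  set X := ‖fresnelTail N v‖
  have hX : 0 ≤ X := norm_nonneg _
  set A := √Real.pi / 2 * N ^ (-(1 / 2) : ℝ) with hA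
  have hApos : 0 < A := by positivity
  have hXA : X ≤ A := norm_fresnelTail_le hN v
  have hhalf : N ^ (-(1 / 2) : ℝ) * N ^ (-(1 / 2) : ℝ) = N⁻¹ := by
    rw [← Real.rpow_add hN, ← Real.rpow_neg_one]; norm_num
  have hXB : X ≤ A * (rootK * (v⁻¹ * N ^ (-(1 / 2) : ℝ))) := by
    refine (norm_fresnelTail_le_inv hN hv).trans ?_
    calc 1 / 2 * (v⁻¹ * N⁻¹) = A * ((√Real.pi)⁻¹ * (v⁻¹ * N ^ (-(1 / 2) : ℝ))) := by
          rw [← hhalf, hA]; field_simp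
      _ ≤ _ := by gcongr; exact inv_sqrt_pi_le_rootK
  have hr := rootK_pos
  calc X = X ^ (1 - γ) * X ^ γ := by
        rw [← Real.rpow_add_of_nonneg hX (by linarith) hγ]; simp
    _ ≤ A ^ (1 - γ) * (A * (rootK * (v⁻¹ * N ^ (-(1 / 2) : ℝ)))) ^ γ := by
        gcongr
    _ = A * (rootK ^ γ * (v ^ (-γ) * N ^ (-(γ / 2)))) := by
        rw [Real.mul_rpow hApos.le (by positivity), ← mul_assoc, ← Real.rpow_add hApos,
          sub_add_cancel, Real.rpow_one, Real.mul_rpow hr.le (by positivity),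
          Real.mul_rpow (by positivity) (by positivity), Real.inv_rpow hv.le, Real.rpow_neg hv.le,
          ← Real.rpow_mul hN.le]
        ring_nf
    _ = _ := by
        rw [constL, hA, show -((1 + γ) / 2) = -(1 / 2) + -(γ / 2) by ring, Real.rpow_add hN]
        ring

/-- The tail to leading order, needed at the cut `v = 1/2`, where the leading part must cancel
against the one from the singular side. -/
theorem norm_fresnelTail_sub_le {N v : ℝ} (hN : 0 < N) (hv : 0 < v) :
    ‖fresnelTail N v + Complex.I / 2 * Complex.exp (-Complex.I * N * (v ^ 2 : ℝ))
        * ((v⁻¹ * N⁻¹ : ℝ) : ℂ)‖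
      ≤ √Real.pi / 4 * (v ^ 2)⁻¹ * N ^ (-(3 / 2) : ℝ) := by
  have h := norm_oscGamma_sub_le_right (μ := 1 / 2) (by norm_num) (by norm_num) hN (pow_pos hv 2)
  rw [sq_rpow_neg_half hv, Real.Gamma_one_half_eq] at h
  have e : fresnelTail N v + Complex.I / 2 * Complex.exp (-Complex.I * N * (v ^ 2 : ℝ))
        * ((v⁻¹ * N⁻¹ : ℝ) : ℂ)
      = (1 / 2 : ℝ) * (starRingEnd ℂ) (oscGamma (1 / 2) N (v ^ 2)
        - Complex.I * Complex.exp (Complex.I * N * (v ^ 2 : ℝ)) * ((v⁻¹ * N⁻¹ : ℝ) : ℂ)) := by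
    rw [map_sub, map_mul, map_mul, conj_exp_I_mul, Complex.conj_I, Complex.conj_ofReal,
      fresnelTail]
    push_cast
    ring
  have hpow : N ^ (-(3 / 2) : ℝ) = N⁻¹ * N ^ (-(1 / 2) : ℝ) := by
    rw [← Real.rpow_neg_one, ← Real.rpow_add hN]; norm_num
  rw [e, norm_mul, RCLike.norm_conj, Complex.norm_real, hpow]
  norm_num at h ⊢
  linarith

/-! ### One-sided integrals with a stationary endpoint -/

theorem integral_rpow_neg_zero {γ l : ℝ} (hγ : γ < 1) :
    ∫ v in (0 : ℝ)..l, v ^ (-γ) = l ^ (1 - γ) / (1 - γ) := by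
  rw [integral_rpow (Or.inl (by linarith)), Real.zero_rpow (by linarith), sub_zero,
    show -γ + 1 = 1 - γ by ring]

/-- Integration by parts for an oscillatory integral whose phase is stationary at the left
endpoint. -/
theorem norm_integral_stationary_sub_le {N γ l M : ℝ} (hN : 0 < N) (hγ : 0 ≤ γ) (hγ1 : γ < 1)
    (hl : 0 < l) (hM : 0 ≤ M) {h h' : ℝ → ℂ} (hc : ContinuousOn h (Icc 0 l))
    (hd : ∀ v ∈ Ioo 0 l, HasDerivAt h (h' v) v) (hc' : ContinuousOn h' (Icc 0 l))
    (hb : ∀ v ∈ Icc 0 l, ‖h' v‖ ≤ M) :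
    ‖(∫ v in (0 : ℝ)..l, h v * Complex.exp (-Complex.I * N * (v ^ 2 : ℝ)))
        - h 0 * fresnelTail N 0 + h l * fresnelTail N l‖
      ≤ constL γ * N ^ (-((1 + γ) / 2)) * M * (l ^ (1 - γ) / (1 - γ)) := by
  have ibp := intervalIntegral.integral_mul_deriv_eq_deriv_mul_of_hasDerivAt (a := 0) (b := l)
    (u := h) (u' := h') (v := fresnelTail N)
    (v' := fun v => -Complex.exp (-Complex.I * N * (v ^ 2 : ℝ)))
    (by rwa [uIcc_of_le hl.le]) (continuous_fresnelTail hN).continuousOn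
    (by rwa [min_eq_left hl.le, max_eq_right hl.le])
    (by rw [min_eq_left hl.le, max_eq_right hl.le]
        exact fun v hv => hasDerivAt_fresnelTail hN hv.1)
    (ContinuousOn.intervalIntegrable (by rwa [uIcc_of_le hl.le]))
    (Continuous.intervalIntegrable (by fun_prop) _ _)
  simp only [mul_neg, intervalIntegral.integral_neg] at ibp
  rw [show (∫ v in (0 : ℝ)..l, h v * Complex.exp (-Complex.I * N * (v ^ 2 : ℝ)))
        - h 0 * fresnelTail N 0 + h l * fresnelTail N l
      = ∫ v in (0 : ℝ)..l, h' v * fresnelTail N v by linear_combination -ibp]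
  -- The interpolated bound leaves `v^(-γ)`, integrable at the stationary point because `γ < 1`.
  rw [← integral_rpow_neg_zero hγ1, ← intervalIntegral.integral_const_mul]
  refine intervalIntegral.norm_integral_le_of_norm_le hl.le
    (Eventually.of_forall fun v hv => ?_)
    ((intervalIntegral.intervalIntegrable_rpow' (by linarith)).const_mul _)
  rw [norm_mul]
  calc ‖h' v‖ * ‖fresnelTail N v‖
      ≤ M * (constL γ * N ^ (-((1 + γ) / 2)) * v ^ (-γ)) :=
        mul_le_mul (hb v (Ioc_subset_Icc_self hv))
          (norm_fresnelTail_le_rpow hN hv.1 hγ hγ1.le) (norm_nonneg _) hM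
    _ = _ := by ring

/-! ### The singular endpoint -/

theorem intervalIntegrable_ofReal_rpow {μ : ℝ} (hμ : 0 < μ) (a b : ℝ) :
    IntervalIntegrable (fun q : ℝ => ((q ^ (μ - 1) : ℝ) : ℂ)) volume a b :=
  have h : IntervalIntegrable (fun q : ℝ => q ^ (μ - 1)) volume a b :=
    intervalIntegral.intervalIntegrable_rpow' (by linarith)
  ⟨h.1.ofReal, h.2.ofReal⟩

/-- The factor that turns `q^(μ - 1)` into `s^(μ - 1) ds/dq` for `s = q (2 - q)`. -/
noncomputable def phaseWeight (μ q : ℝ) : ℝ := (2 - q) ^ (1 - μ) / (2 * (1 - q))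

/-- The derivative of `phaseWeight`. -/
noncomputable def phaseWeightDeriv (μ q : ℝ) : ℝ :=
  phaseWeight μ q * ((1 + μ * (1 - q)) / ((2 - q) * (1 - q)))

/-- The second factor of `phaseWeightDeriv` is the logarithmic derivative `1 / (1 - q) - (1 - μ) /
(2 - q)`. -/
theorem hasDerivAt_phaseWeight {μ q : ℝ} (hq : q < 1) :
    HasDerivAt (phaseWeight μ) (phaseWeightDeriv μ q) q := by
  have h2 : (0 : ℝ) < 2 - q := by linarith
  have h1 : (0 : ℝ) < 1 - q := by linarith
  have d1 : HasDerivAt (fun q : ℝ => (2 - q) ^ (1 - μ)) (-1 * (1 - μ) * (2 - q) ^ (1 - μ - 1)) q :=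
    ((hasDerivAt_id q).const_sub 2).rpow_const (Or.inl h2.ne')
  have d2 : HasDerivAt (fun q : ℝ => 2 * (1 - q)) (2 * -1) q :=
    ((hasDerivAt_id q).const_sub 1).const_mul 2
  refine (d1.div d2 (by positivity)).congr_deriv ?_
  rw [phaseWeightDeriv, phaseWeight, Real.rpow_sub_one h2.ne']
  field_simp
  ring

theorem continuousOn_phaseWeight (μ : ℝ) : ContinuousOn (phaseWeight μ) (Iio 1) :=
  fun _ hq => (hasDerivAt_phaseWeight hq).continuousAt.continuousWithinAt

theorem continuousOn_phaseWeightDeriv (μ : ℝ) : ContinuousOn (phaseWeightDeriv μ) (Iio 1) := by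
  refine (continuousOn_phaseWeight μ).mul (ContinuousOn.div (by fun_prop) (by fun_prop) ?_)
  intro q hq
  have hq' : q < 1 := hq
  have h2 : (0 : ℝ) < 2 - q := by linarith
  have h1 : (0 : ℝ) < 1 - q := by linarith
  positivity

theorem rpow_mul_phaseWeight {μ q : ℝ} (hq : q < 1) :
    (2 - q) ^ (μ - 1) * phaseWeight μ q = (2 * (1 - q))⁻¹ := by
  have h2 : (0 : ℝ) < 2 - q := by linarith
  rw [phaseWeight, mul_div_assoc', ← Real.rpow_add h2]
  simp

theorem phaseWeight_pos (μ : ℝ) {q : ℝ} (hq : q < 1) : 0 < phaseWeight μ q := by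
  have h2 : (0 : ℝ) < 2 - q := by linarith
  have h1 : (0 : ℝ) < 1 - q := by linarith
  unfold phaseWeight
  positivity

theorem phaseWeightDeriv_pos {μ q : ℝ} (hμ : 0 < μ) (hq : q < 1) : 0 < phaseWeightDeriv μ q := by
  have h2 : (0 : ℝ) < 2 - q := by linarith
  have h1 : (0 : ℝ) < 1 - q := by linarith
  have := phaseWeight_pos μ hq
  unfold phaseWeightDeriv
  positivity

theorem rpow_mul_phaseWeight_le {μ q : ℝ} (hq : q ≤ 1 / 2) :
    (2 - q) ^ (μ - 1) * phaseWeight μ q ≤ 1 := by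
  rw [rpow_mul_phaseWeight (by linarith)]
  exact inv_le_one_of_one_le₀ (by linarith)

/-- The product equals `(1 + μ (1 - q)) / (2 (1 - q)² (2 - q))`: numerator at most `2`, denominator
at least `3/4`. -/
theorem rpow_mul_phaseWeightDeriv_le {μ q : ℝ} (hμ : 0 < μ) (hμ1 : μ < 1) (h0 : 0 ≤ q)
    (hq : q ≤ 1 / 2) : (2 - q) ^ (μ - 1) * phaseWeightDeriv μ q ≤ 4 := by
  have h1 : (0 : ℝ) < 1 - q := by linarith
  have h2 : (0 : ℝ) < 2 - q := by linarith
  rw [phaseWeightDeriv, ← mul_assoc, rpow_mul_phaseWeight (by linarith), inv_mul_eq_div, div_div,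
    div_le_iff₀ (by positivity)]
  have : 1 / 4 ≤ (1 - q) * (1 - q) := by nlinarith
  have : 3 / 8 ≤ (2 - q) * ((1 - q) * (1 - q)) := by nlinarith
  nlinarith

/-- The contribution of an algebraic singularity, with the boundary term at the other endpoint
expanded to leading order. -/
theorem norm_integral_singular_sub_le {N μ S W : ℝ} (hN : 0 < N) (hμ : 0 < μ) (hμ1 : μ < 1)
    {G G' : ℝ → ℂ} (hc : ContinuousOn G (Icc 0 (1 / 2)))
    (hd : ∀ v ∈ Ioo (0 : ℝ) (1 / 2), HasDerivAt G (G' v) v)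
    (hc' : ContinuousOn G' (Icc 0 (1 / 2)))
    (hS : ∀ v ∈ Icc (0 : ℝ) (1 / 2), ‖G v‖ ≤ S) (hW : ∀ v ∈ Icc (0 : ℝ) (1 / 2), ‖G' v‖ ≤ W) :
    ‖(∫ q in (0 : ℝ)..(1 / 2), ((q ^ (μ - 1) : ℝ) : ℂ) * G q
          * Complex.exp (-Complex.I * N * ((q - 1) ^ 2 : ℝ)))
        - Complex.exp (-Complex.I * N) * (oscGamma μ N 0 * (phaseWeight μ 0 * G 0))
        + Complex.I * Complex.exp (-Complex.I * N * ((1 / 2) ^ 2 : ℝ))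
          * (((1 / 2) ^ (μ - 1) * N⁻¹ : ℝ) : ℂ) * G (1 / 2)‖
      ≤ (4 * S + W) * N⁻¹ * ((1 / 2) ^ μ / μ) + (1 - μ) * (2 ^ (3 - μ) / 3) * S * (N⁻¹ * N⁻¹) := by
  have hS0 : 0 ≤ S := (norm_nonneg _).trans (hS 0 (by norm_num))
  have hW0 : 0 ≤ W := (norm_nonneg _).trans (hW 0 (by norm_num))
  have hsub : Icc (0 : ℝ) (1 / 2) ⊆ Iio 1 := fun q hq => by
    have := hq.2; simp only [mem_Iio]; linarith
  have huIcc : uIcc (0 : ℝ) (1 / 2) = Icc 0 (1 / 2) := uIcc_of_le (by norm_num)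
  have hmin : min (0 : ℝ) (1 / 2) = 0 := by norm_num
  have hmax : max (0 : ℝ) (1 / 2) = 1 / 2 := by norm_num
  set A : ℝ → ℂ := fun q => oscGamma μ N (q * (2 - q)) with hA
  set V : ℝ → ℂ := fun q => ((q ^ (μ - 1) : ℝ) : ℂ) * ((((2 - q) ^ (μ - 1) * (2 * (1 - q)) : ℝ) : ℂ)
    * Complex.exp (Complex.I * N * (q * (2 - q) : ℝ))) with hV
  have hAc : ContinuousOn A (Icc 0 (1 / 2)) :=
    (continuousOn_oscGamma hμ hμ1.le hN).comp (by fun_prop) fun q hq => by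
      have := hq.1; have := hq.2
      exact mul_nonneg hq.1 (by linarith)
  have hwc := Complex.continuous_ofReal.comp_continuousOn ((continuousOn_phaseWeight μ).mono hsub)
  have hwc' := Complex.continuous_ofReal.comp_continuousOn
    ((continuousOn_phaseWeightDeriv μ).mono hsub)
  have hVi : IntervalIntegrable V volume 0 (1 / 2) := by
    refine (intervalIntegrable_ofReal_rpow hμ 0 (1 / 2)).mul_continuousOn ?_
    rw [huIcc]
    refine ContinuousOn.mul (Complex.continuous_ofReal.comp_continuousOn ?_) (by fun_prop)
    refine ContinuousOn.mul (ContinuousOn.rpow_const (by fun_prop) fun q hq => Or.inl ?_)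
      (by fun_prop)
    have := hq.2
    linarith
  have ibp := intervalIntegral.integral_mul_deriv_eq_deriv_mul_of_hasDerivAt (a := 0) (b := 1 / 2)
    (u := fun q => (phaseWeight μ q : ℂ) * G q)
    (u' := fun q => (phaseWeightDeriv μ q : ℂ) * G q + phaseWeight μ q * G' q)
    (v := fun q => -A q) (v' := V)
    (by rw [huIcc]; exact hwc.mul hc) (by rw [huIcc]; exact hAc.neg)
    (by rw [hmin, hmax]
        intro q hq
        have hq1 : q < 1 := by have := hq.2; linarith
        exact (hasDerivAt_phaseWeight hq1).ofReal_comp.mul (hd q hq))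
    (by rw [hmin, hmax]
        intro q hq
        have hq0 := hq.1
        have hq1 : q < 1 := by have := hq.2; linarith
        have h2 : 0 < 2 - q := by linarith
        have ds : HasDerivAt (fun q : ℝ => q * (2 - q)) (1 * (2 - q) + q * -1) q :=
          (hasDerivAt_id q).mul ((hasDerivAt_id q).const_sub 2)
        refine (HasDerivAt.scomp (h := fun q : ℝ => q * (2 - q)) q
          (hasDerivAt_oscGamma hμ1.le hN (mul_pos hq0 h2)) ds).neg.congr_deriv ?_
        rw [hV, Complex.real_smul, Real.mul_rpow hq0.le h2.le]
        push_cast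
        ring)
    (ContinuousOn.intervalIntegrable
      (by rw [huIcc]; exact (hwc'.mul hc).add (hwc.mul hc')))
    hVi
  -- Since `(q - 1)² = 1 - q (2 - q)`, the phase is linear in `s = q (2 - q)`, and `V` is the
  -- derivative of `-A`.
  have hint : (∫ q in (0 : ℝ)..(1 / 2), ((q ^ (μ - 1) : ℝ) : ℂ) * G q
          * Complex.exp (-Complex.I * N * ((q - 1) ^ 2 : ℝ)))
      = Complex.exp (-Complex.I * N) * ∫ q in (0 : ℝ)..(1 / 2), (phaseWeight μ q : ℂ) * G q * V q := by
    rw [← intervalIntegral.integral_const_mul]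
    refine intervalIntegral.integral_congr fun q hq => ?_
    rw [huIcc] at hq
    have hq1 : q < 1 := hsub hq
    have he : Complex.exp (-Complex.I * N * ((q - 1) ^ 2 : ℝ))
        = Complex.exp (-Complex.I * N) * Complex.exp (Complex.I * N * (q * (2 - q) : ℝ)) := by
      rw [← Complex.exp_add]
      congr 1
      push_cast
      ring
    have hw : (((2 - q) ^ (μ - 1) : ℝ) : ℂ) * phaseWeight μ q * (2 * (1 - q)) = 1 := by
      rw [← Complex.ofReal_mul, rpow_mul_phaseWeight hq1]
      have : ((1 - q : ℝ) : ℂ) ≠ 0 := by exact_mod_cast (sub_pos.2 hq1).ne'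
      push_cast at this ⊢
      field_simp
    simp only [hV, he]
    push_cast
    linear_combination (-((q ^ (μ - 1) : ℝ) : ℂ) * G q * Complex.exp (-Complex.I * N)
      * Complex.exp (Complex.I * N * ((q : ℂ) * (2 - (q : ℂ))))) * hw
  have hI : ‖∫ q in (0 : ℝ)..(1 / 2),
      ((phaseWeightDeriv μ q : ℂ) * G q + phaseWeight μ q * G' q) * -A q‖
        ≤ (4 * S + W) * N⁻¹ * ((1 / 2) ^ μ / μ) := by
    have : ∫ q in (0 : ℝ)..(1 / 2), q ^ (μ - 1) = (1 / 2) ^ μ / μ := by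
      rw [integral_rpow (Or.inl (by linarith)), sub_add_cancel, Real.zero_rpow hμ.ne', sub_zero]
    rw [← this, ← intervalIntegral.integral_const_mul]
    refine intervalIntegral.norm_integral_le_of_norm_le (by norm_num)
      (Eventually.of_forall fun q hq => ?_)
      ((intervalIntegral.intervalIntegrable_rpow' (by linarith)).const_mul _)
    have hq' := Ioc_subset_Icc_self hq
    have hq0 := hq.1
    have hq1 : q < 1 := hsub hq'
    have h2 : 0 < 2 - q := by linarith
    -- This bound has the full decay `N⁻¹`; its blow-up `q^(μ - 1)` is integrable, and the factor in
    -- `2 - q` is absorbed by the weight.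
    have hAq : ‖A q‖ ≤ q ^ (μ - 1) * (2 - q) ^ (μ - 1) * N⁻¹ := by
      rw [← Real.mul_rpow hq0.le h2.le]
      exact norm_oscGamma_le_left hμ1.le hN (mul_pos hq0 h2)
    have hw := phaseWeight_pos μ hq1
    have hw' := phaseWeightDeriv_pos hμ hq1
    have hu : ‖(phaseWeightDeriv μ q : ℂ) * G q + phaseWeight μ q * G' q‖
        ≤ phaseWeightDeriv μ q * S + phaseWeight μ q * W := by
      refine (norm_add_le _ _).trans ?_
      rw [norm_mul, norm_mul, Complex.norm_real, Complex.norm_real, Real.norm_of_nonneg hw.le,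
        Real.norm_of_nonneg hw'.le]
      gcongr
      exacts [hS q hq', hW q hq']
    rw [norm_mul, norm_neg]
    calc _ ≤ (phaseWeightDeriv μ q * S + phaseWeight μ q * W)
          * (q ^ (μ - 1) * (2 - q) ^ (μ - 1) * N⁻¹) :=
          mul_le_mul hu hAq (norm_nonneg _) (by positivity)
      _ = ((2 - q) ^ (μ - 1) * phaseWeightDeriv μ q * S
          + (2 - q) ^ (μ - 1) * phaseWeight μ q * W) * N⁻¹ * q ^ (μ - 1) := by ring
      _ ≤ (4 * S + 1 * W) * N⁻¹ * q ^ (μ - 1) := by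
          gcongr
          exacts [rpow_mul_phaseWeightDeriv_le hμ hμ1 hq0.le hq.2, rpow_mul_phaseWeight_le hq.2]
      _ = _ := by ring
  -- The cut `q = 1/2` corresponds to `s = 3/4`; `R` is the error of the leading term of `oscGamma`
  -- there.
  set R : ℂ := A (1 / 2) - Complex.I * Complex.exp (Complex.I * N * ((1 / 2) * (2 - 1 / 2) : ℝ))
    * ((((1 / 2) * (2 - 1 / 2)) ^ (μ - 1) * N⁻¹ : ℝ) : ℂ) with hR
  have hRle : ‖R‖ ≤ (1 - μ) * N⁻¹ * (((1 / 2) * (2 - 1 / 2)) ^ (μ - 1 - 1) * N⁻¹) :=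
    norm_oscGamma_sub_le_left hμ1.le hN (by norm_num)
  have hwhalf : phaseWeight μ (1 / 2) = (2 - 1 / 2) ^ (1 - μ) := by
    rw [phaseWeight]; norm_num
  -- The weight removes the factor `(3/2)^(μ - 1)`, so the leading boundary term takes the form that
  -- the Fresnel side can cancel. The extra `(3/4)⁻¹` in the bound of `R` produces the `3` in `2^(3
  -- - μ) / 3`.
  have hpw : ((1 / 2 : ℝ) * (2 - 1 / 2)) ^ (μ - 1) * phaseWeight μ (1 / 2) = (1 / 2) ^ (μ - 1) := by
    rw [hwhalf, Real.mul_rpow (by norm_num) (by norm_num), mul_assoc,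
      ← Real.rpow_add (by norm_num)]
    simp
  have htwo : (2 : ℝ) ^ (3 - μ) = 4 * (1 / 2) ^ (μ - 1) := by
    rw [one_div, Real.inv_rpow (by norm_num), ← Real.rpow_neg (by norm_num),
      show (3 - μ) = 2 + -(μ - 1) by ring, Real.rpow_add (by norm_num)]
    norm_num
  have hRG : ‖R * (phaseWeight μ (1 / 2) * G (1 / 2))‖
      ≤ (1 - μ) * (2 ^ (3 - μ) / 3) * S * (N⁻¹ * N⁻¹) := by
    have hw := phaseWeight_pos μ (q := 1 / 2) (by norm_num)
    rw [norm_mul, norm_mul, Complex.norm_real, Real.norm_of_nonneg hw.le]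
    calc _ ≤ (1 - μ) * N⁻¹ * (((1 / 2) * (2 - 1 / 2)) ^ (μ - 1 - 1) * N⁻¹)
          * (phaseWeight μ (1 / 2) * S) := by
          have : 0 ≤ 1 - μ := by linarith
          have := hS (1 / 2) (by norm_num)
          gcongr
      _ = _ := by
          rw [Real.rpow_sub_one (by norm_num) (μ - 1), htwo, ← hpw]
          ring
  have he : Complex.exp (-Complex.I * N) * Complex.exp (Complex.I * N * ((1 / 2) * (2 - 1 / 2) : ℝ))
      = Complex.exp (-Complex.I * N * ((1 / 2) ^ 2 : ℝ)) := by
    rw [← Complex.exp_add]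
    congr 1
    push_cast
    ring
  have hA0 : A 0 = oscGamma μ N 0 := by simp [hA]
  have hnorm : ‖Complex.exp (-Complex.I * N)‖ = 1 := by
    rw [show -Complex.I * N = ((-N : ℝ) : ℂ) * Complex.I by push_cast; ring]
    exact Complex.norm_exp_ofReal_mul_I _
  rw [hint, ibp, hA0]
  have hfin : Complex.exp (-Complex.I * N) * ((phaseWeight μ (1 / 2) : ℂ) * G (1 / 2) * -A (1 / 2)
          - (phaseWeight μ 0 : ℂ) * G 0 * -oscGamma μ N 0
          - ∫ q in (0 : ℝ)..(1 / 2),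
            ((phaseWeightDeriv μ q : ℂ) * G q + phaseWeight μ q * G' q) * -A q)
        - Complex.exp (-Complex.I * N) * (oscGamma μ N 0 * (phaseWeight μ 0 * G 0))
        + Complex.I * Complex.exp (-Complex.I * N * ((1 / 2) ^ 2 : ℝ))
          * (((1 / 2) ^ (μ - 1) * N⁻¹ : ℝ) : ℂ) * G (1 / 2)
      = -(Complex.exp (-Complex.I * N) * ((∫ q in (0 : ℝ)..(1 / 2),
            ((phaseWeightDeriv μ q : ℂ) * G q + phaseWeight μ q * G' q) * -A q)
          + R * (phaseWeight μ (1 / 2) * G (1 / 2)))) := by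
    rw [← he, ← hpw, hR]
    push_cast
    ring
  rw [hfin, norm_neg, norm_mul, hnorm, one_mul]
  exact (norm_add_le _ _).trans (add_le_add hI hRG)

/-! ### The normalized oscillatory integral: singularity at `0`, stationary point at `1` -/

theorem hasDerivAt_rpow_mul {G : ℝ → ℂ} {g : ℂ} {μ y : ℝ} (hy : 0 < y) (h : HasDerivAt G g y) :
    HasDerivAt (fun y : ℝ => ((y ^ (μ - 1) : ℝ) : ℂ) * G y)
      ((((μ - 1) * y ^ (μ - 1 - 1) : ℝ) : ℂ) * G y + ((y ^ (μ - 1) : ℝ) : ℂ) * g) y :=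
  ((Real.hasDerivAt_rpow_const (Or.inl hy.ne')).ofReal_comp.mul h)

theorem norm_deriv_rpow_mul_le {μ m y S W : ℝ} (hμ1 : μ ≤ 1) (hm : 0 < m) (hy : m ≤ y)
    {z w : ℂ} (hz : ‖z‖ ≤ S) (hw : ‖w‖ ≤ W) :
    ‖(((μ - 1) * y ^ (μ - 1 - 1) : ℝ) : ℂ) * z + ((y ^ (μ - 1) : ℝ) : ℂ) * w‖
      ≤ (1 - μ) * m ^ (μ - 2) * S + m ^ (μ - 1) * W := by
  have hy0 : 0 < y := hm.trans_le hy
  have h1 : y ^ (μ - 1 - 1) ≤ m ^ (μ - 2) := by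
    rw [show μ - 1 - 1 = μ - 2 by ring]
    exact Real.rpow_le_rpow_of_nonpos hm hy (by linarith)
  have h2 : y ^ (μ - 1) ≤ m ^ (μ - 1) := Real.rpow_le_rpow_of_nonpos hm hy (by linarith)
  refine (norm_add_le _ _).trans ?_
  rw [norm_mul, norm_mul, Complex.norm_real, Complex.norm_real, norm_mul,
    Real.norm_of_nonpos (by linarith : μ - 1 ≤ 0),
    Real.norm_of_nonneg (Real.rpow_nonneg hy0.le _),
    Real.norm_of_nonneg (Real.rpow_nonneg hy0.le _), neg_sub]
  have : 0 ≤ 1 - μ := by linarith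
  gcongr

theorem continuousOn_ofReal_rpow (a : ℝ) {s : Set ℝ} (hs : s ⊆ Ioi 0) :
    ContinuousOn (fun y : ℝ => ((y ^ a : ℝ) : ℂ)) s :=
  Complex.continuous_ofReal.comp_continuousOn
    (continuousOn_id.rpow_const fun _ hy => Or.inl (ne_of_gt (hs hy)))

/-- Expansion of an oscillatory integral with an algebraic singularity at `0` and a stationary
point at `1`, with explicit remainder. -/
theorem norm_integral_normalized_sub_le {N μ S W B γ : ℝ} (hN : 0 < N) (hμ : 0 < μ) (hμ1 : μ < 1)
    (hγ : 0 ≤ γ) (hγ1 : γ < 1) (hB : 1 < B) {G G' : ℝ → ℂ} (hc : ContinuousOn G (Icc 0 B))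
    (hd : ∀ v ∈ Ioo 0 B, HasDerivAt G (G' v) v) (hc' : ContinuousOn G' (Icc 0 B))
    (hS : ∀ v ∈ Icc 0 B, ‖G v‖ ≤ S) (hW : ∀ v ∈ Icc 0 B, ‖G' v‖ ≤ W) (hGB : G B = 0) :
    ‖(∫ q in (0 : ℝ)..B, ((q ^ (μ - 1) : ℝ) : ℂ) * G q
          * Complex.exp (-Complex.I * N * ((q - 1) ^ 2 : ℝ)))
        - Complex.exp (-Complex.I * N) * (oscGamma μ N 0 * (((2 : ℝ) ^ (-μ) : ℝ) * G 0))
        - 2 * fresnelTail N 0 * G 1‖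
      ≤ 2 ^ (2 - μ) / μ * (2 - μ) * S * N⁻¹ + 2 ^ (1 - μ) / μ * W * N⁻¹
        + (1 - μ) * (2 ^ (3 - μ) / 3) * S * (N⁻¹ * N⁻¹)
        + constL γ / (1 - γ) * 2 ^ (2 - μ) * (1 - μ) * S * N ^ (-((1 + γ) / 2))
        + constL γ / (1 - γ) * 2 ^ (1 - μ) * W * N ^ (-((1 + γ) / 2))
        + √Real.pi / 2 ^ (μ - 2) * S * N ^ (-(3 / 2) : ℝ)
        + constL γ / (1 - γ) * (1 - μ) * B ^ (1 - γ) * S * N ^ (-((1 + γ) / 2))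
        + constL γ / (1 - γ) * B ^ (1 - γ) * W * N ^ (-((1 + γ) / 2)) := by
  have hB0 : (0 : ℝ) < B := by linarith
  have hS0 : 0 ≤ S := (norm_nonneg _).trans (hS 0 ⟨le_rfl, hB0.le⟩)
  have hW0 : 0 ≤ W := (norm_nonneg _).trans (hW 0 ⟨le_rfl, hB0.le⟩)
  have hμ' : 0 ≤ 1 - μ := by linarith
  have hγ' : 0 < 1 - γ := by linarith
  set D : ℝ → ℂ := fun q => ((q ^ (μ - 1) : ℝ) : ℂ) * G q
          * Complex.exp (-Complex.I * N * ((q - 1) ^ 2 : ℝ)) with hD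
  set f : ℝ → ℂ := fun y => ((y ^ (μ - 1) : ℝ) : ℂ) * G y with hf
  set f' : ℝ → ℂ := fun y => (((μ - 1) * y ^ (μ - 1 - 1) : ℝ) : ℂ) * G y
    + ((y ^ (μ - 1) : ℝ) : ℂ) * G' y with hf'
  have hDi : IntervalIntegrable D volume 0 B := by
    have hGe : ContinuousOn (fun q => G q * Complex.exp (-Complex.I * N * ((q - 1) ^ 2 : ℝ)))
        (uIcc 0 B) := by
      rw [uIcc_of_le hB0.le]
      exact hc.mul (by fun_prop)
    refine ((intervalIntegrable_ofReal_rpow hμ 0 B).mul_continuousOn hGe).congr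
      fun q _ => ?_
    simp only [hD]
    ring
  have hmono : ∀ {a b : ℝ}, 0 ≤ a → a ≤ b → b ≤ B → IntervalIntegrable D volume a b := by
    intro a b ha hab hb
    refine hDi.mono_set ?_
    rw [uIcc_of_le hab, uIcc_of_le hB0.le]
    exact Icc_subset_Icc ha hb
  -- Both pieces adjacent to `q = 1` are written in the distance `v` from the stationary point.
  have hsplit : ∫ q in (0 : ℝ)..B, D q = (∫ q in (0 : ℝ)..(1 / 2), D q)
      + (∫ v in (0 : ℝ)..(1 / 2), D (1 - v)) + ∫ v in (0 : ℝ)..(B - 1), D (1 + v) := by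
    rw [intervalIntegral.integral_comp_sub_left, intervalIntegral.integral_comp_add_left,
      show (1 : ℝ) - 1 / 2 = 1 / 2 by norm_num, sub_zero, add_zero, add_sub_cancel,
      intervalIntegral.integral_add_adjacent_intervals
        (hmono le_rfl (by norm_num) (by linarith)) (hmono (by norm_num) (by norm_num) hB.le),
      intervalIntegral.integral_add_adjacent_intervals
        (hmono le_rfl (by norm_num) hB.le) (hmono (by norm_num) hB.le le_rfl)]
  have hDleft : ∀ v, D (1 - v) = f (1 - v) * Complex.exp (-Complex.I * N * (v ^ 2 : ℝ)) := by
    intro v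
    simp only [hD, hf]
    congr 3
    push_cast
    ring
  have hDright : ∀ v, D (1 + v) = f (1 + v) * Complex.exp (-Complex.I * N * (v ^ 2 : ℝ)) := by
    intro v
    simp only [hD, hf]
    congr 3
    push_cast
    ring
  have hsubIcc : Ioi (0 : ℝ) ∩ Icc 0 B ⊆ Ioi 0 := inter_subset_left
  have hfc : ContinuousOn f (Ioi 0 ∩ Icc 0 B) :=
    (continuousOn_ofReal_rpow _ hsubIcc).mul (hc.mono inter_subset_right)
  have hfc' : ContinuousOn f' (Ioi 0 ∩ Icc 0 B) := by
    refine ContinuousOn.add (ContinuousOn.mul ?_ (hc.mono inter_subset_right))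
      ((continuousOn_ofReal_rpow _ hsubIcc).mul (hc'.mono inter_subset_right))
    simp only [Complex.ofReal_mul]
    exact continuousOn_const.mul (continuousOn_ofReal_rpow _ hsubIcc)
  have hfd : ∀ y ∈ Ioo 0 B, HasDerivAt f (f' y) y := fun y hy =>
    hasDerivAt_rpow_mul hy.1 (hd y hy)
  -- the singular endpoint
  have h1 := norm_integral_singular_sub_le hN hμ hμ1 (G := G) (G' := G') (S := S) (W := W)
    (hc.mono (Icc_subset_Icc le_rfl (by linarith)))
    (fun v hv => hd v ⟨hv.1, hv.2.trans (by linarith)⟩)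
    (hc'.mono (Icc_subset_Icc le_rfl (by linarith)))
    (fun v hv => hS v ⟨hv.1, hv.2.trans (by linarith)⟩)
    (fun v hv => hW v ⟨hv.1, hv.2.trans (by linarith)⟩)
  rw [show phaseWeight μ 0 = 2 ^ (-μ) by
    rw [phaseWeight, Real.rpow_neg two_pos.le, sub_zero, Real.rpow_sub two_pos]
    norm_num
    field_simp] at h1
  -- the two sides of the stationary point
  have hmapL : MapsTo (fun v : ℝ => 1 - v) (Icc 0 (1 / 2)) (Ioi 0 ∩ Icc 0 B) := fun v hv => by
    have := hv.1
    have := hv.2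
    exact ⟨by simp only [mem_Ioi]; linarith, by linarith, by linarith⟩
  have hmapR : MapsTo (fun v : ℝ => 1 + v) (Icc 0 (B - 1)) (Ioi 0 ∩ Icc 0 B) := fun v hv => by
    have := hv.1
    have := hv.2
    exact ⟨by simp only [mem_Ioi]; linarith, by linarith, by linarith⟩
  have h2 := norm_integral_stationary_sub_le hN hγ hγ1 (l := 1 / 2) (by norm_num)
    (M := (1 - μ) * (1 / 2) ^ (μ - 2) * S + (1 / 2) ^ (μ - 1) * W) (by positivity)
    (h := fun v => f (1 - v)) (h' := fun v => -f' (1 - v))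
    (hfc.comp (by fun_prop) hmapL)
    (fun v hv => by
      have := hv.1
      have := hv.2
      have := HasDerivAt.scomp (h := fun v : ℝ => 1 - v) v
        (hfd (1 - v) ⟨by linarith, by linarith⟩) ((hasDerivAt_id v).const_sub 1)
      simpa [Function.comp_def] using this)
    (hfc'.comp (by fun_prop) hmapL).neg
    (fun v hv => by
      have h := hmapL hv
      rw [norm_neg]
      exact norm_deriv_rpow_mul_le hμ1.le (by norm_num) (by linarith [hv.2]) (hS _ h.2) (hW _ h.2))
  -- Here `q ≥ 1`, so the powers of `q` are bounded by `1`; on the left they are bounded by their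
  -- values at `1/2`.
  have h3 := norm_integral_stationary_sub_le hN hγ hγ1 (l := B - 1) (by linarith)
    (M := (1 - μ) * 1 ^ (μ - 2) * S + 1 ^ (μ - 1) * W) (by positivity)
    (h := fun v => f (1 + v)) (h' := fun v => f' (1 + v))
    (hfc.comp (by fun_prop) hmapR)
    (fun v hv => by
      have := hv.1
      have := hv.2
      have := HasDerivAt.scomp (h := fun v : ℝ => 1 + v) v
        (hfd (1 + v) ⟨by linarith, by linarith⟩) ((hasDerivAt_id v).const_add 1)
      simpa [Function.comp_def] using this)
    (hfc'.comp (by fun_prop) hmapR)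
    (fun v hv => by
      have h := hmapR hv
      exact norm_deriv_rpow_mul_le hμ1.le one_pos (by linarith [hv.1]) (hS _ h.2) (hW _ h.2))
  have hfB : f B = 0 := by simp [hf, hGB]
  have hf1 : f 1 = G 1 := by simp [hf]
  simp only [← hDleft, ← hDright, sub_zero, add_zero, add_sub_cancel, hfB, hf1, zero_mul,
    show (1 : ℝ) - 1 / 2 = 1 / 2 by norm_num, Real.one_rpow, mul_one, one_mul] at h2 h3
  -- the boundary terms at the point of separation
  have h4 : ‖Complex.I * Complex.exp (-Complex.I * N * ((1 / 2) ^ 2 : ℝ))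
          * (((1 / 2) ^ (μ - 1) * N⁻¹ : ℝ) : ℂ) * G (1 / 2) + f (1 / 2) * fresnelTail N (1 / 2)‖
        ≤ (1 / 2) ^ (μ - 1) * S * (√Real.pi / 4 * ((1 / 2) ^ 2)⁻¹ * N ^ (-(3 / 2) : ℝ)) := by
    -- The leading term from the singular side is the negative of the leading part of `f (1/2)`
    -- times the Fresnel tail, so only the error of the latter remains.
    have e : Complex.I * Complex.exp (-Complex.I * N * ((1 / 2) ^ 2 : ℝ))
          * (((1 / 2) ^ (μ - 1) * N⁻¹ : ℝ) : ℂ) * G (1 / 2) + f (1 / 2) * fresnelTail N (1 / 2)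
        = f (1 / 2) * (fresnelTail N (1 / 2)
          + Complex.I / 2 * Complex.exp (-Complex.I * N * ((1 / 2) ^ 2 : ℝ))
          * (((1 / 2)⁻¹ * N⁻¹ : ℝ) : ℂ)) := by
      simp only [hf]
      push_cast
      ring
    rw [e, norm_mul]
    refine mul_le_mul ?_ (norm_fresnelTail_sub_le hN (by norm_num)) (norm_nonneg _) (by positivity)
    rw [hf, norm_mul, Complex.norm_real, Real.norm_of_nonneg (by positivity)]
    gcongr
    exact hS _ ⟨by norm_num, by linarith⟩
  have hkey : (∫ q in (0 : ℝ)..B, D q)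
        - Complex.exp (-Complex.I * N) * (oscGamma μ N 0 * (((2 : ℝ) ^ (-μ) : ℝ) * G 0))
        - 2 * fresnelTail N 0 * G 1
      = ((∫ q in (0 : ℝ)..(1 / 2), D q)
        - Complex.exp (-Complex.I * N) * (oscGamma μ N 0 * (((2 : ℝ) ^ (-μ) : ℝ) * G 0))
        + Complex.I * Complex.exp (-Complex.I * N * ((1 / 2) ^ 2 : ℝ))
          * (((1 / 2) ^ (μ - 1) * N⁻¹ : ℝ) : ℂ) * G (1 / 2))
        + ((∫ v in (0 : ℝ)..(1 / 2), D (1 - v)) - G 1 * fresnelTail N 0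
          + f (1 / 2) * fresnelTail N (1 / 2))
        + ((∫ v in (0 : ℝ)..(B - 1), D (1 + v)) - G 1 * fresnelTail N 0)
        - (Complex.I * Complex.exp (-Complex.I * N * ((1 / 2) ^ 2 : ℝ))
          * (((1 / 2) ^ (μ - 1) * N⁻¹ : ℝ) : ℂ) * G (1 / 2)
          + f (1 / 2) * fresnelTail N (1 / 2)) := by
    rw [hsplit]
    ring
  rw [hkey]
  refine (norm_sub_le _ _).trans ((add_le_add ((norm_add_le _ _).trans (add_le_add
    ((norm_add_le _ _).trans (add_le_add h1 h2)) h3)) h4).trans ?_)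
  have e1 : (1 / 2 : ℝ) ^ (μ - 1) = 2 ^ (1 - μ) := by
    rw [one_div, Real.inv_rpow two_pos.le, ← Real.rpow_neg two_pos.le, neg_sub]
  have e2 : (1 / 2 : ℝ) ^ (μ - 2) = 2 ^ (2 - μ) := by
    rw [one_div, Real.inv_rpow two_pos.le, ← Real.rpow_neg two_pos.le, neg_sub]
  have e3 : (2 : ℝ) ^ (2 - μ) = 2 * 2 ^ (1 - μ) := by
    rw [show 2 - μ = 1 + (1 - μ) by ring, Real.rpow_add two_pos, Real.rpow_one]
  have e4 : (2 : ℝ) ^ (1 - μ) = 2 * (1 / 2) ^ μ := by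
    rw [one_div, Real.inv_rpow two_pos.le, Real.rpow_sub two_pos, Real.rpow_one, div_eq_mul_inv]
  have e5 : √Real.pi / 2 ^ (μ - 2) = √Real.pi * 2 ^ (2 - μ) := by
    rw [← neg_sub 2 μ, Real.rpow_neg two_pos.le, div_inv_eq_mul]
  -- The sharper bounds obtained are now weakened to the stated constants; here `1 ≤ 2 - μ` and `W ≤
  -- 2 W`.
  have b1 : (4 * S + W) * N⁻¹ * ((1 / 2) ^ μ / μ)
      ≤ 2 ^ (2 - μ) / μ * (2 - μ) * S * N⁻¹ + 2 ^ (1 - μ) / μ * W * N⁻¹ := by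
    have hX : 0 ≤ (1 / 2 : ℝ) ^ μ / μ * N⁻¹ := by positivity
    rw [e3, e4]
    calc _ = ((1 / 2 : ℝ) ^ μ / μ * N⁻¹) * (4 * S + W) := by ring
      _ ≤ ((1 / 2 : ℝ) ^ μ / μ * N⁻¹) * (4 * (2 - μ) * S + 2 * W) := by
          gcongr ?_ * ?_
          nlinarith
      _ = _ := by ring
  have hL := constL_pos γ
  have hY : 0 ≤ constL γ / (1 - γ) * N ^ (-((1 + γ) / 2)) := by positivity
  have b2 : constL γ * N ^ (-((1 + γ) / 2))
        * ((1 - μ) * (1 / 2) ^ (μ - 2) * S + (1 / 2) ^ (μ - 1) * W) * ((1 / 2) ^ (1 - γ) / (1 - γ))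
      ≤ constL γ / (1 - γ) * 2 ^ (2 - μ) * (1 - μ) * S * N ^ (-((1 + γ) / 2))
        + constL γ / (1 - γ) * 2 ^ (1 - μ) * W * N ^ (-((1 + γ) / 2)) := by
    have hle : (1 / 2 : ℝ) ^ (1 - γ) ≤ 1 := Real.rpow_le_one (by norm_num) (by norm_num) hγ'.le
    rw [e1, e2]
    calc _ = (constL γ / (1 - γ) * N ^ (-((1 + γ) / 2)))
          * ((1 - μ) * 2 ^ (2 - μ) * S + 2 ^ (1 - μ) * W) * (1 / 2) ^ (1 - γ) := by ring
      _ ≤ (constL γ / (1 - γ) * N ^ (-((1 + γ) / 2)))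
          * ((1 - μ) * 2 ^ (2 - μ) * S + 2 ^ (1 - μ) * W) * 1 := by gcongr
      _ = _ := by ring
  have b3 : constL γ * N ^ (-((1 + γ) / 2)) * ((1 - μ) * S + W) * ((B - 1) ^ (1 - γ) / (1 - γ))
      ≤ constL γ / (1 - γ) * (1 - μ) * B ^ (1 - γ) * S * N ^ (-((1 + γ) / 2))
        + constL γ / (1 - γ) * B ^ (1 - γ) * W * N ^ (-((1 + γ) / 2)) := by
    have hle : (B - 1) ^ (1 - γ) ≤ B ^ (1 - γ) :=
      Real.rpow_le_rpow (by linarith) (by linarith) hγ'.le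
    calc _ = (constL γ / (1 - γ) * N ^ (-((1 + γ) / 2))) * ((1 - μ) * S + W)
          * (B - 1) ^ (1 - γ) := by ring
      _ ≤ (constL γ / (1 - γ) * N ^ (-((1 + γ) / 2))) * ((1 - μ) * S + W) * B ^ (1 - γ) := by
          gcongr
      _ = _ := by ring
  have b4 : (1 / 2) ^ (μ - 1) * S * (√Real.pi / 4 * ((1 / 2) ^ 2)⁻¹ * N ^ (-(3 / 2) : ℝ))
      ≤ √Real.pi / 2 ^ (μ - 2) * S * N ^ (-(3 / 2) : ℝ) := by
    have hZ : 0 ≤ √Real.pi * 2 ^ (1 - μ) * S * N ^ (-(3 / 2) : ℝ) := by positivity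
    rw [e1, e5, e3]
    nlinarith
  linarith

/-! ### The solution as a function -/

theorem integrable_singularAmplitude {p₁ p₂ μ : ℝ} {r : ℝ → ℂ} (hμ : 0 < μ) (hp : p₁ < p₂)
    (hr : ContinuousOn r (Icc p₁ p₂)) : Integrable (singularAmplitude p₁ p₂ μ r) := by
  have h0 := ((intervalIntegrable_ofReal_rpow hμ (p₁ - p₁) (p₂ - p₁)).comp_sub_right p₁)
  rw [sub_add_cancel, sub_add_cancel] at h0
  have h1 := h0.mul_continuousOn (g := r) (by rwa [uIcc_of_le hp.le])
  rw [intervalIntegrable_iff_integrableOn_Ioo_of_le hp.le] at h1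
  exact (integrable_indicator_iff measurableSet_Ioo).2 h1

theorem continuous_propagator (t : ℝ) : Continuous (propagator t) := by
  unfold propagator
  fun_prop

theorem norm_propagator (t p : ℝ) : ‖propagator t p‖ = 1 := by
  rw [propagator, show -Complex.I * t * (p : ℂ) ^ 2 = ((-(t * p ^ 2) : ℝ) : ℂ) * Complex.I by
    push_cast; ring]
  exact Complex.norm_exp_ofReal_mul_I _

/-- The Fourier integral `(2 π)⁻¹ ∫ A(p) exp (-i t p² + i x p) dp`. -/
noncomputable def wavePacket (A : ℝ → ℂ) (t x : ℝ) : ℂ :=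
  (2 * Real.pi : ℂ)⁻¹ * ∫ p : ℝ, A p * propagator t p * Complex.exp (Complex.I * x * p)

theorem norm_wavePacket_integrand (A : ℝ → ℂ) (t x p : ℝ) :
    ‖A p * propagator t p * Complex.exp (Complex.I * x * p)‖ = ‖A p‖ := by
  rw [norm_mul, norm_mul, norm_propagator, norm_exp_I_mul_mul, mul_one, mul_one]

theorem continuous_wavePacket {A : ℝ → ℂ} (hA : Integrable A) (t : ℝ) :
    Continuous (wavePacket A t) := by
  refine continuous_const.mul (continuous_of_dominated (bound := fun p => ‖A p‖) (fun x => ?_)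
    (fun x => Eventually.of_forall fun p => (norm_wavePacket_integrand A t x p).le) hA.norm
    (Eventually.of_forall fun p => by fun_prop))
  exact (hA.aestronglyMeasurable.mul (continuous_propagator t).aestronglyMeasurable).mul
    (by fun_prop : Continuous fun p : ℝ => Complex.exp (Complex.I * x * p)).aestronglyMeasurable

theorem norm_wavePacket_le (A : ℝ → ℂ) (t x : ℝ) :
    ‖wavePacket A t x‖ ≤ ‖(2 * Real.pi : ℂ)⁻¹‖ * ∫ p : ℝ, ‖A p‖ := by
  rw [wavePacket, norm_mul]
  gcongr
  refine (norm_integral_le_integral_norm _).trans (le_of_eq ?_)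
  simp only [norm_wavePacket_integrand]

/-- Moving the multiplier and the inverse transform onto the test function and applying Fubini,
legitimate because the amplitude and the test function are integrable. -/
theorem representedBy_schrodingerFlow {u₀ : 𝓢'(ℝ, ℂ)} {A : ℝ → ℂ} (hA : Integrable A)
    (h : RepresentedBy (fourierD u₀) A) (t : ℝ) :
    RepresentedBy (schrodingerFlow u₀ t) (wavePacket A t) := by
  intro φ
  have hφ : Integrable (φ : ℝ → ℂ) := φ.integrable
  refine ⟨hφ.bdd_mul (continuous_wavePacket hA t).aestronglyMeasurable
    (Eventually.of_forall (norm_wavePacket_le A t)), ?_⟩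
  change fourierD u₀ (SchwartzMap.smulLeftCLM ℂ (propagator t) (fourierInvS φ)) = _
  rw [(h _).2]
  have hprod : Integrable (Function.uncurry fun p x : ℝ =>
      (A p * φ x) * (propagator t p * Complex.exp (Complex.I * x * p)))
      (volume.prod volume) := by
    refine (hA.mul_prod hφ).mul_bdd (c := 1) (Continuous.aestronglyMeasurable ?_)
      (Eventually.of_forall fun z => ?_)
    · exact ((continuous_propagator t).comp continuous_fst).mul (by fun_prop)
    · rw [norm_mul, norm_propagator, norm_exp_I_mul_mul, one_mul]
  calc ∫ p, A p * SchwartzMap.smulLeftCLM ℂ (propagator t) (fourierInvS φ) p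
      = ∫ p, (2 * Real.pi : ℂ)⁻¹ * ∫ x, (A p * φ x)
          * (propagator t p * Complex.exp (Complex.I * x * p)) := by
        congr 1
        ext p
        rw [SchwartzMap.smulLeftCLM_apply_apply (propagator_hasTemperateGrowth t),
          fourierInvS_apply, smul_eq_mul]
        have : ∫ x : ℝ, (A p * φ x) * (propagator t p * Complex.exp (Complex.I * x * p))
            = A p * propagator t p * ∫ x : ℝ, φ x * Complex.exp (Complex.I * p * x) := by
          rw [← integral_const_mul]
          congr 1
          ext x
          rw [mul_right_comm Complex.I]
          ring
        rw [this]
        ring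
    _ = (2 * Real.pi : ℂ)⁻¹ * ∫ x, ∫ p, (A p * φ x)
          * (propagator t p * Complex.exp (Complex.I * x * p)) := by
        rw [integral_const_mul, integral_integral_swap hprod]
    _ = ∫ x, wavePacket A t x * φ x := by
        rw [← integral_const_mul]
        congr 1
        ext x
        rw [wavePacket, mul_assoc, ← integral_mul_const]
        congr 2
        ext p
        ring

/-- Compactly supported smooth functions already separate locally integrable functions up to null
sets. This transfers the expansion of `wavePacket` to every solution. -/
theorem RepresentedBy.eq_of_continuous {T : 𝓢'(ℝ, ℂ)} {f g : ℝ → ℂ} (hf : Continuous f)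
    (hg : Continuous g) (hTf : RepresentedBy T f) (hTg : RepresentedBy T g) : f = g := by
  have hae : ∀ᵐ x, f x = g x := by
    refine ae_eq_of_integral_contDiff_smul_eq hf.locallyIntegrable hg.locallyIntegrable
      fun φ hφ hcφ => ?_
    have hc : HasCompactSupport (fun x => (φ x : ℂ)) :=
      hcφ.comp_left (g := fun y : ℝ => (y : ℂ)) Complex.ofReal_zero
    have hs : ContDiff ℝ ∞ (fun x => (φ x : ℂ)) := Complex.ofRealCLM.contDiff.comp hφ
    have h := (hTf (hc.toSchwartzMap hs)).2.symm.trans (hTg (hc.toSchwartzMap hs)).2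
    simpa [mul_comm] using h
  exact (hf.ae_eq_iff_eq volume hg).1 hae

theorem InitialCondition.isSolution_wavePacket {p₁ p₂ μ : ℝ} {u₀ : 𝓢'(ℝ, ℂ)} {r : ℝ → ℂ}
    (h : InitialCondition p₁ p₂ μ u₀ r) :
    IsSolution u₀ (wavePacket (singularAmplitude p₁ p₂ μ r)) := fun t _ =>
  have hA := integrable_singularAmplitude h.mu_mem.1 h.lt h.contDiffOn.continuousOn
  ⟨continuous_wavePacket hA t, representedBy_schrodingerFlow hA h.fourier_eq t⟩

theorem IsSolution.eq {u₀ : 𝓢'(ℝ, ℂ)} {u v : ℝ → ℝ → ℂ} (hu : IsSolution u₀ u)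
    (hv : IsSolution u₀ v) {t : ℝ} (ht : 0 < t) : u t = v t :=
  (hu t ht).2.eq_of_continuous (hu t ht).1 (hv t ht).1 (hv t ht).2

/-! ### Suprema over the band -/

theorem norm_le_supNorm {p₁ p₂ : ℝ} {v : ℝ → ℂ} (hv : ContinuousOn v (Icc p₁ p₂)) {p : ℝ}
    (hp : p ∈ Icc p₁ p₂) : ‖v p‖ ≤ supNorm p₁ p₂ v :=
  le_csSup (isCompact_Icc.image_of_continuousOn hv.norm).bddAbove (mem_image_of_mem _ hp)

theorem supNorm_nonneg (p₁ p₂ : ℝ) (v : ℝ → ℂ) : 0 ≤ supNorm p₁ p₂ v := by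
  refine Real.sSup_nonneg ?_
  rintro _ ⟨p, _, rfl⟩
  exact norm_nonneg _

theorem sobolevNorm_nonneg (p₁ p₂ : ℝ) (v : ℝ → ℂ) : 0 ≤ sobolevNorm p₁ p₂ v :=
  (supNorm_nonneg p₁ p₂ v).trans (le_max_left _ _)

theorem constCommon_nonneg {p₁ p₂ μ δ : ℝ} (hμ : 0 < μ) (hμ1 : μ < 1) (hδ : δ < 1) (hp : p₁ < p₂)
    (v : ℝ → ℂ) (k : Fin 8) : 0 ≤ constCommon p₁ p₂ μ δ v k := by
  have h1 : 0 < 1 - (2 * δ - 1) := by linarith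
  have h2 : 0 < 1 - μ := by linarith
  have h3 : 0 < 2 - μ := by linarith
  have h4 : 0 < p₂ - p₁ := by linarith
  have hW := sobolevNorm_nonneg p₁ p₂ v
  have hS := supNorm_nonneg p₁ p₂ v
  have hL := constL_pos (2 * δ - 1)
  fin_cases k <;> simp only [constCommon, Fin.zero_eta, Fin.mk_one, Fin.reduceFinMk,
    Matrix.cons_val] <;> positivity

/-! ### Geometry of the curve -/

theorem threshold_pos {ε p₁ p₂ : ℝ} (hp : p₁ < p₂) : 0 < threshold ε p₁ p₂ :=
  Real.rpow_pos_of_pos (sub_pos.2 hp) _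

theorem rpow_neg_lt_of_threshold_lt {ε p₁ p₂ t : ℝ} (hε : 0 < ε) (hp : p₁ < p₂)
    (ht : threshold ε p₁ p₂ < t) : t ^ (-ε) < p₂ - p₁ := by
  have h := Real.rpow_lt_rpow_of_neg (threshold_pos hp) ht (neg_lt_zero.2 hε)
  rwa [threshold, ← Real.rpow_mul (sub_pos.2 hp).le, neg_mul_neg, one_div_mul_cancel hε.ne',
    Real.rpow_one] at h

theorem mem_region_of_mem_curve {ε p₁ p₂ t x : ℝ} (hε : 0 < ε) (hp : p₁ < p₂)
    (hx : (t, x) ∈ curve ε p₁) (ht : threshold ε p₁ p₂ < t) : (t, x) ∈ region ε p₁ p₂ := by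
  have h := rpow_neg_lt_of_threshold_lt hε hp ht
  obtain ⟨h0, h1⟩ := hx
  simp only at h0 h1
  refine ⟨h0, h1.ge, ?_, ht⟩
  simp only [h1]
  linarith

theorem eq_of_mem_curve {ε p₁ t x : ℝ} (hx : (t, x) ∈ curve ε p₁) :
    x = 2 * t * (p₁ + t ^ (-ε)) := by
  obtain ⟨h0, h1⟩ := hx
  simp only at h0 h1
  rw [div_eq_iff h0.ne'] at h1
  rw [h1]
  ring

/-! ### Normalization of the Fourier integral -/

/-- Completing the square gives the phase `t (p₁ + d)² - t (p - p₁ - d)²`, and then `p = p₁ + d q`.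
The prefactor `d^μ` is the Jacobian `d` times `d^(μ - 1)` from the singularity. -/
theorem wavePacket_singularAmplitude {p₁ p₂ μ d t : ℝ} {r : ℝ → ℂ} (hp : p₁ < p₂) (hd : 0 < d) :
    wavePacket (singularAmplitude p₁ p₂ μ r) t (2 * t * (p₁ + d))
      = ((d ^ μ : ℝ) : ℂ) * Complex.exp (Complex.I * ((t * (p₁ + d) ^ 2 : ℝ) : ℂ))
        * ∫ q in (0 : ℝ)..((p₂ - p₁) / d), ((q ^ (μ - 1) : ℝ) : ℂ) * scaled r (p₁ + d * q)
          * Complex.exp (-Complex.I * (t * d ^ 2 : ℝ) * ((q - 1) ^ 2 : ℝ)) := by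
  set f : ℝ → ℂ := fun p => (((p - p₁) ^ (μ - 1) : ℝ) : ℂ) * r p * propagator t p
    * Complex.exp (Complex.I * (2 * t * (p₁ + d) : ℝ) * p) with hf
  have h1 : ∫ p : ℝ, singularAmplitude p₁ p₂ μ r p * propagator t p
      * Complex.exp (Complex.I * (2 * t * (p₁ + d) : ℝ) * p) = ∫ p in p₁..p₂, f p := by
    rw [intervalIntegral.integral_of_le hp.le, integral_Ioc_eq_integral_Ioo,
      ← integral_indicator measurableSet_Ioo]
    congr 1
    ext p
    by_cases hpm : p ∈ Ioo p₁ p₂ <;> simp [singularAmplitude, hpm, hf]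
  have h2 := intervalIntegral.integral_comp_add_mul (a := 0) (b := (p₂ - p₁) / d) f hd.ne' p₁
  rw [mul_zero, add_zero, mul_div_cancel₀ _ hd.ne', add_sub_cancel] at h2
  have h3 : ∫ p in p₁..p₂, f p = (d : ℂ) * ∫ q in (0 : ℝ)..((p₂ - p₁) / d), f (p₁ + d * q) := by
    rw [h2, Complex.real_smul, ← mul_assoc, ← Complex.ofReal_mul, mul_inv_cancel₀ hd.ne',
      Complex.ofReal_one, one_mul]
  rw [wavePacket, h1, h3, ← mul_assoc, ← intervalIntegral.integral_const_mul,
    ← intervalIntegral.integral_const_mul]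
  refine intervalIntegral.integral_congr fun q hq => ?_
  rw [uIcc_of_le (div_nonneg (sub_pos.2 hp).le hd.le)] at hq
  have he : propagator t (p₁ + d * q)
      * Complex.exp (Complex.I * (2 * t * (p₁ + d) : ℝ) * (p₁ + d * q : ℝ))
      = Complex.exp (Complex.I * ((t * (p₁ + d) ^ 2 : ℝ) : ℂ))
        * Complex.exp (-Complex.I * (t * d ^ 2 : ℝ) * ((q - 1) ^ 2 : ℝ)) := by
    rw [propagator, ← Complex.exp_add, ← Complex.exp_add]
    congr 1
    push_cast
    ring
  have hpow : (p₁ + d * q - p₁) ^ (μ - 1) = d ^ (μ - 1) * q ^ (μ - 1) := by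
    rw [add_sub_cancel_left, Real.mul_rpow hd.le hq.1]
  have hdμ : d ^ μ = d * d ^ (μ - 1) := by
    rw [mul_comm, ← Real.rpow_add_one hd.ne', sub_add_cancel]
  simp only [hf, scaled]
  rw [mul_assoc _ (propagator t _), he, hpow, hdμ]
  push_cast
  ring

/-- Expansion of the solution at a point whose stationary frequency is at distance `d` from the
singular frequency. -/
theorem norm_wavePacket_sub_le {p₁ p₂ μ d t γ : ℝ} {r : ℝ → ℂ} (hμ : 0 < μ) (hμ1 : μ < 1)
    (hγ : 0 ≤ γ) (hγ1 : γ < 1) (ht : 0 < t) (hd : 0 < d) (hdp : d < p₂ - p₁)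
    (hr : ContDiffOn ℝ 1 r (Icc p₁ p₂)) (hr2 : r p₂ = 0) :
    ‖wavePacket (singularAmplitude p₁ p₂ μ r) t (2 * t * (p₁ + d))
        - ((d ^ μ : ℝ) : ℂ) * Complex.exp (Complex.I * ((t * (p₁ + d) ^ 2 : ℝ) : ℂ))
          * (2 * fresnelTail (t * d ^ 2) 0 * scaled r (p₁ + d))
        - ((d ^ μ : ℝ) : ℂ) * Complex.exp (Complex.I * ((t * (p₁ + d) ^ 2 : ℝ) : ℂ))
          * (Complex.exp (-Complex.I * (t * d ^ 2 : ℝ))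
            * (oscGamma μ (t * d ^ 2) 0 * (((2 : ℝ) ^ (-μ) : ℝ) * scaled r p₁)))‖
      ≤ d ^ μ * (2 ^ (2 - μ) / μ * (2 - μ) * sobolevNorm p₁ p₂ (scaled r) * (t * d ^ 2)⁻¹
        + 2 ^ (1 - μ) / μ * (d * sobolevNorm p₁ p₂ (scaled r)) * (t * d ^ 2)⁻¹
        + (1 - μ) * (2 ^ (3 - μ) / 3) * supNorm p₁ p₂ (scaled r)
          * ((t * d ^ 2)⁻¹ * (t * d ^ 2)⁻¹)
        + constL γ / (1 - γ) * 2 ^ (2 - μ) * (1 - μ) * sobolevNorm p₁ p₂ (scaled r)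
          * (t * d ^ 2) ^ (-((1 + γ) / 2))
        + constL γ / (1 - γ) * 2 ^ (1 - μ) * (d * sobolevNorm p₁ p₂ (scaled r))
          * (t * d ^ 2) ^ (-((1 + γ) / 2))
        + √Real.pi / 2 ^ (μ - 2) * supNorm p₁ p₂ (scaled r) * (t * d ^ 2) ^ (-(3 / 2) : ℝ)
        + constL γ / (1 - γ) * (1 - μ) * ((p₂ - p₁) / d) ^ (1 - γ)
          * sobolevNorm p₁ p₂ (scaled r) * (t * d ^ 2) ^ (-((1 + γ) / 2))
        + constL γ / (1 - γ) * ((p₂ - p₁) / d) ^ (1 - γ) * (d * sobolevNorm p₁ p₂ (scaled r))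
          * (t * d ^ 2) ^ (-((1 + γ) / 2))) := by
  have hp : p₁ < p₂ := by linarith
  set v := scaled r with hv
  set S := supNorm p₁ p₂ v with hSdef
  set W := sobolevNorm p₁ p₂ v with hWdef
  set N := t * d ^ 2 with hN
  have hNpos : 0 < N := by positivity
  have hvc : ContDiffOn ℝ 1 v (Icc p₁ p₂) := contDiffOn_const.mul hr
  have hdc : ContinuousOn (derivWithin v (Icc p₁ p₂)) (Icc p₁ p₂) :=
    hvc.continuousOn_derivWithin (uniqueDiffOn_Icc hp) le_rfl
  have hmaps : MapsTo (fun q : ℝ => p₁ + d * q) (Icc 0 ((p₂ - p₁) / d)) (Icc p₁ p₂) := by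
    intro q hq
    have h1 := mul_nonneg hd.le hq.1
    have h2 := (le_div_iff₀' hd).1 hq.2
    exact ⟨by linarith, by linarith⟩
  have hB : 1 < (p₂ - p₁) / d := (one_lt_div hd).2 hdp
  have hSW : S ≤ W := le_max_left _ _
  have hS0 : 0 ≤ S := supNorm_nonneg _ _ _
  -- By the chain rule the derivative in `q` gains a factor `d`, hence `d * W`.
  have key := norm_integral_normalized_sub_le (N := N) (S := S) (W := d * W) hNpos hμ hμ1 hγ hγ1 hB
    (G := fun q => v (p₁ + d * q)) (G' := fun q => (d : ℂ) * derivWithin v (Icc p₁ p₂) (p₁ + d * q))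
    (hvc.continuousOn.comp (by fun_prop) hmaps)
    (fun q hq => by
      have h1 := mul_pos hd hq.1
      have h2 := (lt_div_iff₀' hd).1 hq.2
      have hq' : p₁ + d * q ∈ Ioo p₁ p₂ := ⟨by linarith, by linarith⟩
      have hnhds : Icc p₁ p₂ ∈ 𝓝 (p₁ + d * q) := Icc_mem_nhds hq'.1 hq'.2
      have hder := ((hvc.differentiableOn one_ne_zero _
        (Ioo_subset_Icc_self hq')).hasDerivWithinAt).hasDerivAt hnhds
      have := HasDerivAt.scomp (h := fun q : ℝ => p₁ + d * q) q hder
        (((hasDerivAt_id q).const_mul d).const_add p₁)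
      simpa [Function.comp_def] using this)
    (continuousOn_const.mul (hdc.comp (by fun_prop) hmaps))
    (fun q hq => norm_le_supNorm hvc.continuousOn (hmaps hq))
    (fun q hq => by
      rw [norm_mul, Complex.norm_real, Real.norm_of_nonneg hd.le]
      gcongr
      exact (norm_le_supNorm hdc (hmaps hq)).trans (le_max_right _ _))
    (by simp [mul_div_cancel₀ _ hd.ne', hv, scaled, hr2])
  simp only [mul_zero, add_zero, mul_one] at key
  have hnorm : ‖((d ^ μ : ℝ) : ℂ) * Complex.exp (Complex.I * ((t * (p₁ + d) ^ 2 : ℝ) : ℂ))‖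
      = d ^ μ := by
    rw [norm_mul, mul_comm Complex.I, Complex.norm_exp_ofReal_mul_I, Complex.norm_real,
      Real.norm_of_nonneg (by positivity), mul_one]
  rw [wavePacket_singularAmplitude hp hd, ← mul_sub, ← mul_sub, norm_mul, hnorm, sub_right_comm]
  have hγ' : 0 < 1 - γ := by linarith
  have hμ' : 0 < 1 - μ := by linarith
  have hμ2 : 0 < 2 - μ := by linarith
  have hL := constL_pos γ
  have hB0 : 0 < (p₂ - p₁) / d := by linarith
  -- What is left is `S ≤ W`, used in the first, fourth and seventh terms.
  refine mul_le_mul_of_nonneg_left (key.trans ?_) (by positivity)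
  gcongr

/-! ### The expansion on the curve -/

theorem mul_rpow_neg_sq {ε t : ℝ} (ht : 0 < t) : t * (t ^ (-ε)) ^ 2 = t ^ (1 - 2 * ε) := by
  rw [show 1 - 2 * ε = 1 + -ε * (2 : ℕ) by push_cast; ring, Real.rpow_add ht, Real.rpow_one,
    Real.rpow_mul ht.le, Real.rpow_natCast]

/-- A power of the distance times a power of the normalized time, along the curve. -/
theorem rpow_mul_rpow_curve {ε t : ℝ} (ht : 0 < t) (a b : ℝ) :
    (t ^ (-ε)) ^ a * (t * (t ^ (-ε)) ^ 2) ^ (-b) = t ^ (-b + ε * (2 * b - a)) := by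
  rw [mul_rpow_neg_sq ht, ← Real.rpow_mul ht.le, ← Real.rpow_mul ht.le, ← Real.rpow_add ht]
  congr 1
  ring

/-- Each term is a constant times `d^a N^(-b) = t^(-b + ε (2b - a))`. Here `a = μ`, raised by one
when a derivative contributes a factor `d` and lowered by `1 - γ` when `B^(1 - γ)` is present. -/
theorem sum_constCommon_eq {p₁ p₂ μ ε δ t : ℝ} (ht : 0 < t) (hp : p₁ < p₂) (v : ℝ → ℂ) :
    (t ^ (-ε)) ^ μ * (2 ^ (2 - μ) / μ * (2 - μ) * sobolevNorm p₁ p₂ v * (t * (t ^ (-ε)) ^ 2)⁻¹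
        + 2 ^ (1 - μ) / μ * (t ^ (-ε) * sobolevNorm p₁ p₂ v) * (t * (t ^ (-ε)) ^ 2)⁻¹
        + (1 - μ) * (2 ^ (3 - μ) / 3) * supNorm p₁ p₂ v
          * ((t * (t ^ (-ε)) ^ 2)⁻¹ * (t * (t ^ (-ε)) ^ 2)⁻¹)
        + constL (2 * δ - 1) / (1 - (2 * δ - 1)) * 2 ^ (2 - μ) * (1 - μ) * sobolevNorm p₁ p₂ v
          * (t * (t ^ (-ε)) ^ 2) ^ (-((1 + (2 * δ - 1)) / 2))
        + constL (2 * δ - 1) / (1 - (2 * δ - 1)) * 2 ^ (1 - μ)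
          * (t ^ (-ε) * sobolevNorm p₁ p₂ v)
          * (t * (t ^ (-ε)) ^ 2) ^ (-((1 + (2 * δ - 1)) / 2))
        + √Real.pi / 2 ^ (μ - 2) * supNorm p₁ p₂ v * (t * (t ^ (-ε)) ^ 2) ^ (-(3 / 2) : ℝ)
        + constL (2 * δ - 1) / (1 - (2 * δ - 1)) * (1 - μ)
          * ((p₂ - p₁) / t ^ (-ε)) ^ (1 - (2 * δ - 1))
          * sobolevNorm p₁ p₂ v * (t * (t ^ (-ε)) ^ 2) ^ (-((1 + (2 * δ - 1)) / 2))
        + constL (2 * δ - 1) / (1 - (2 * δ - 1)) * ((p₂ - p₁) / t ^ (-ε)) ^ (1 - (2 * δ - 1))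
          * (t ^ (-ε) * sobolevNorm p₁ p₂ v)
          * (t * (t ^ (-ε)) ^ 2) ^ (-((1 + (2 * δ - 1)) / 2)))
      = ∑ k, constCommon p₁ p₂ μ δ v k * t ^ (-betaCommon δ k + ε * alphaCommon μ δ k) := by
  have hd : 0 < t ^ (-ε) := Real.rpow_pos_of_pos ht _
  have hN : 0 < t * (t ^ (-ε)) ^ 2 := by positivity
  have hb : 0 < p₂ - p₁ := sub_pos.2 hp
  have hsucc : (t ^ (-ε)) ^ (μ + 1) = (t ^ (-ε)) ^ μ * t ^ (-ε) := Real.rpow_add_one hd.ne' μ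
  have hinv : (t * (t ^ (-ε)) ^ 2) ^ (-1 : ℝ) = (t * (t ^ (-ε)) ^ 2)⁻¹ := Real.rpow_neg_one _
  have hinv2 : (t * (t ^ (-ε)) ^ 2) ^ (-2 : ℝ)
      = (t * (t ^ (-ε)) ^ 2)⁻¹ * (t * (t ^ (-ε)) ^ 2)⁻¹ := by
    rw [← hinv, ← Real.rpow_add hN]
    norm_num
  have hquot : ((p₂ - p₁) / t ^ (-ε)) ^ (1 - (2 * δ - 1)) * (t ^ (-ε)) ^ (1 - (2 * δ - 1))
      = (p₂ - p₁) ^ (1 - (2 * δ - 1)) := by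
    rw [← Real.mul_rpow (by positivity) hd.le, div_mul_cancel₀ _ hd.ne']
  have hμδ : (t ^ (-ε)) ^ μ
      = (t ^ (-ε)) ^ (1 - (2 * δ - 1)) * (t ^ (-ε)) ^ (μ - (1 - (2 * δ - 1))) := by
    rw [← Real.rpow_add hd, add_sub_cancel]
  have hμδ' : (t ^ (-ε)) ^ (μ - (1 - (2 * δ - 1)) + 1)
      = (t ^ (-ε)) ^ (μ - (1 - (2 * δ - 1))) * t ^ (-ε) := Real.rpow_add_one hd.ne' _
  have hδ : (1 + (2 * δ - 1)) / 2 = δ := by ring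
  have e0 := rpow_mul_rpow_curve (ε := ε) ht μ 1
  have e1 := rpow_mul_rpow_curve (ε := ε) ht (μ + 1) 1
  have e2 := rpow_mul_rpow_curve (ε := ε) ht μ 2
  have e3 := rpow_mul_rpow_curve (ε := ε) ht μ δ
  have e4 := rpow_mul_rpow_curve (ε := ε) ht (μ + 1) δ
  have e5 := rpow_mul_rpow_curve (ε := ε) ht μ (3 / 2)
  have e6 := rpow_mul_rpow_curve (ε := ε) ht (μ - (1 - (2 * δ - 1))) δ
  have e7 := rpow_mul_rpow_curve (ε := ε) ht (μ - (1 - (2 * δ - 1)) + 1) δ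
  rw [hinv] at e0
  rw [hinv, hsucc] at e1
  rw [hinv2] at e2
  rw [hsucc] at e4
  rw [hμδ'] at e7
  rw [show -1 + ε * (2 * 1 - μ) = -1 + ε * (2 - μ) by ring] at e0
  rw [show -1 + ε * (2 * 1 - (μ + 1)) = -1 + ε * (1 - μ) by ring] at e1
  rw [show -2 + ε * (2 * 2 - μ) = -2 + ε * (4 - μ) by ring] at e2
  rw [show -δ + ε * (2 * δ - μ) = -δ + ε * (1 + (2 * δ - 1) - μ) by ring] at e3
  rw [show -δ + ε * (2 * δ - (μ + 1)) = -δ + ε * ((2 * δ - 1) - μ) by ring] at e4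
  rw [show -(3 / 2) + ε * (2 * (3 / 2) - μ) = -(3 / 2) + ε * (3 - μ) by ring] at e5
  rw [show -δ + ε * (2 * δ - (μ - (1 - (2 * δ - 1)))) = -δ + ε * (2 - μ) by ring] at e6
  rw [show -δ + ε * (2 * δ - (μ - (1 - (2 * δ - 1)) + 1)) = -δ + ε * (1 - μ) by ring] at e7
  simp only [Fin.sum_univ_eight, constCommon, betaCommon, alphaCommon, Matrix.cons_val]
  rw [← e0, ← e1, ← e2, ← e3, ← e4, ← e5, ← e6, ← e7, hδ, ← hquot]
  -- Only the last two terms need `d^μ` split, so that `d^(1 - γ)` can cancel the denominator of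
  -- `B^(1 - γ)`.
  linear_combination (constL (2 * δ - 1) / (1 - (2 * δ - 1))
    * ((p₂ - p₁) / t ^ (-ε)) ^ (1 - (2 * δ - 1)) * sobolevNorm p₁ p₂ v
    * (t * (t ^ (-ε)) ^ 2) ^ (-δ) * ((1 - μ) + t ^ (-ε))) * hμδ

/-- The expansion of the solution on the curve, with both leading terms. -/
theorem norm_sub_leading_le {p₁ p₂ μ ε δ t x : ℝ} {u₀ : 𝓢'(ℝ, ℂ)} {r : ℝ → ℂ} {u : ℝ → ℝ → ℂ}
    (hu₀ : InitialCondition p₁ p₂ μ u₀ r) (hu : IsSolution u₀ u) (hε : 0 < ε)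
    (hδ : 1 / 2 + ε < δ) (hδ1 : δ < 1) (hx : (t, x) ∈ curve ε p₁)
    (ht : threshold ε p₁ p₂ < t) :
    ‖u t x - coeffH ε p₁ r t * ((t ^ (-(1 / 2) + ε * (1 - μ)) : ℝ) : ℂ)
        - coeffK p₁ μ r t x * ((t ^ (-μ + ε * μ) : ℝ) : ℂ)‖
      ≤ ∑ k, constCommon p₁ p₂ μ δ (scaled r) k
        * t ^ (-betaCommon δ k + ε * alphaCommon μ δ k) := by
  have hμ := hu₀.mu_mem.1
  have hμ1 := hu₀.mu_mem.2
  have ht0 : 0 < t := hx.1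
  have hd : 0 < t ^ (-ε) := Real.rpow_pos_of_pos ht0 _
  have hN : 0 < t * (t ^ (-ε)) ^ 2 := by positivity
  have hxe := eq_of_mem_curve hx
  have key := norm_wavePacket_sub_le (γ := 2 * δ - 1) hμ hμ1 (by linarith) (by linarith) ht0 hd
    (rpow_neg_lt_of_threshold_lt hε hu₀.lt ht) hu₀.contDiffOn hu₀.right_eq_zero
  rw [sum_constCommon_eq ht0 hu₀.lt, ← hxe] at key
  rw [hu.eq hu₀.isSolution_wavePacket ht0]
  have hH := rpow_mul_rpow_curve (ε := ε) ht0 μ (1 / 2)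
  rw [show -(1 / 2) + ε * (2 * (1 / 2) - μ) = -(1 / 2) + ε * (1 - μ) by ring] at hH
  have hK := rpow_mul_rpow_curve (ε := ε) ht0 μ μ
  rw [show -μ + ε * (2 * μ - μ) = -μ + ε * μ by ring] at hK
  have hpi : ((√Real.pi : ℝ) : ℂ) ≠ 0 := by
    exact_mod_cast (Real.sqrt_pos.2 Real.pi_pos).ne'
  have hpisq : (Real.pi : ℂ) = ((√Real.pi : ℝ) : ℂ) * ((√Real.pi : ℝ) : ℂ) := by
    rw [← Complex.ofReal_mul, Real.mul_self_sqrt Real.pi_pos.le]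
  have hHterm : (((t ^ (-ε)) ^ μ : ℝ) : ℂ)
        * Complex.exp (Complex.I * ((t * (p₁ + t ^ (-ε)) ^ 2 : ℝ) : ℂ))
        * (2 * fresnelTail (t * (t ^ (-ε)) ^ 2) 0 * scaled r (p₁ + t ^ (-ε)))
      = coeffH ε p₁ r t * ((t ^ (-(1 / 2) + ε * (1 - μ)) : ℝ) : ℂ) := by
    have hc : (1 / (2 * Real.pi) : ℂ) * ((√Real.pi : ℝ) : ℂ) = 1 / (2 * ((√Real.pi : ℝ) : ℂ)) := by
      rw [hpisq]
      field_simp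
    rw [two_mul_fresnelTail_zero hN, coeffH, scaled, ← hH]
    simp only [Complex.ofReal_mul, Complex.ofReal_div, Complex.ofReal_one, Complex.ofReal_ofNat]
    rw [← hc]
    ring
  have hKterm : (((t ^ (-ε)) ^ μ : ℝ) : ℂ)
        * Complex.exp (Complex.I * ((t * (p₁ + t ^ (-ε)) ^ 2 : ℝ) : ℂ))
        * (Complex.exp (-Complex.I * (t * (t ^ (-ε)) ^ 2 : ℝ))
            * (oscGamma μ (t * (t ^ (-ε)) ^ 2) 0 * (((2 : ℝ) ^ (-μ) : ℝ) * scaled r p₁)))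
      = coeffK p₁ μ r t x * ((t ^ (-μ + ε * μ) : ℝ) : ℂ) := by
    have he : Complex.exp (Complex.I * ((t * (p₁ + t ^ (-ε)) ^ 2 : ℝ) : ℂ))
        * Complex.exp (-Complex.I * (t * (t ^ (-ε)) ^ 2 : ℝ))
        = Complex.exp (Complex.I * ((-t * p₁ ^ 2 + x * p₁ : ℝ) : ℂ)) := by
      rw [← Complex.exp_add, hxe]
      congr 1
      push_cast
      ring
    rw [oscGamma_zero hμ hN, coeffK, scaled, ← hK, ← he, Real.rpow_neg two_pos.le]
    simp only [Complex.ofReal_mul, Complex.ofReal_div, Complex.ofReal_inv]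
    ring
  rwa [hHterm, hKterm] at key

/-! ### Exponents -/

/-- The seventh term is the binding one: for it the claim is exactly `δ > 1/2 + ε`. The others need
only `ε < 1/2`, `ε > 0` and `δ > 1/2`. -/
theorem exponent_common_lt {μ ε δ : ℝ} (hε : 0 < ε) (hε1 : ε < 1 / 2) (hδ : 1 / 2 + ε < δ)
    (k : Fin 8) :
    -betaCommon δ k + ε * alphaCommon μ δ k < -(1 / 2) + ε * (1 - μ) := by
  have h1 : 0 < ε * δ := by nlinarith
  -- This product is exactly the gap for the fourth term.
  have h2 : 0 < (1 - 2 * ε) * (δ - 1 / 2) := mul_pos (by linarith) (by linarith)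
  fin_cases k <;> simp only [betaCommon, alphaCommon, Fin.zero_eta, Fin.mk_one, Fin.reduceFinMk,
    Matrix.cons_val] <;> nlinarith

/-! ### The modulus of the leading coefficients -/

theorem norm_coeffH (ε p₁ : ℝ) (r : ℝ → ℂ) (t : ℝ) :
    ‖coeffH ε p₁ r t‖ = 1 / (2 * √Real.pi) * ‖r (p₁ + t ^ (-ε))‖ := by
  have h : ∀ a : ℝ, ‖Complex.exp (-Complex.I * a)‖ = 1 := fun a => by
    rw [show -Complex.I * a = ((-a : ℝ) : ℂ) * Complex.I by push_cast; ring]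
    exact Complex.norm_exp_ofReal_mul_I _
  rw [coeffH, norm_mul, norm_mul, norm_mul, h, mul_comm Complex.I, Complex.norm_exp_ofReal_mul_I,
    Complex.norm_real, Real.norm_of_nonneg (by positivity), mul_one, mul_one]

theorem norm_coeffK {μ : ℝ} (hμ : 0 < μ) (p₁ : ℝ) (r : ℝ → ℂ) (t x : ℝ) :
    ‖coeffK p₁ μ r t x‖ = 1 / (2 * Real.pi) * (Real.Gamma μ / 2 ^ μ) * ‖r p₁‖ := by
  have hΓ := Real.Gamma_pos_of_pos hμ
  rw [coeffK, norm_mul, norm_mul, norm_mul, mul_comm Complex.I, Complex.norm_exp_ofReal_mul_I,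
    mul_comm Complex.I, Complex.norm_exp_ofReal_mul_I, Complex.norm_real,
    Real.norm_of_nonneg (by have := Real.pi_pos; positivity), mul_one, mul_one]

theorem norm_scaled (r : ℝ → ℂ) (p : ℝ) : ‖scaled r p‖ = 1 / (2 * Real.pi) * ‖r p‖ := by
  rw [scaled, norm_mul, Complex.norm_real, Real.norm_of_nonneg (by have := Real.pi_pos; positivity)]

theorem norm_coeffK_le {p₁ p₂ μ : ℝ} {r : ℝ → ℂ} (hμ : 0 < μ) (hp : p₁ < p₂)
    (hr : ContinuousOn r (Icc p₁ p₂)) (t x : ℝ) :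
    ‖coeffK p₁ μ r t x‖ ≤ Real.Gamma μ / 2 ^ μ * supNorm p₁ p₂ (scaled r) := by
  have h := norm_le_supNorm (v := scaled r) (continuousOn_const.mul hr) (left_mem_Icc.2 hp.le)
  have hΓ := Real.Gamma_pos_of_pos hμ
  rw [norm_scaled] at h
  calc ‖coeffK p₁ μ r t x‖ = Real.Gamma μ / 2 ^ μ * (1 / (2 * Real.pi) * ‖r p₁‖) := by
        rw [norm_coeffK hμ]; ring
    _ ≤ _ := by gcongr

/-- This provides `C_0` when the term `H` is the weaker one; the factor `√π` is `(2 √π)⁻¹` measured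
in units of `(2 π)⁻¹`. -/
theorem norm_coeffH_le {p₁ p₂ ε t : ℝ} {r : ℝ → ℂ} (hr : ContinuousOn r (Icc p₁ p₂))
    (ht : p₁ + t ^ (-ε) ∈ Icc p₁ p₂) :
    ‖coeffH ε p₁ r t‖ ≤ √Real.pi * supNorm p₁ p₂ (scaled r) := by
  have h := norm_le_supNorm (v := scaled r) (continuousOn_const.mul hr) ht
  rw [norm_scaled] at h
  have hpi := Real.sqrt_pos.2 Real.pi_pos
  calc ‖coeffH ε p₁ r t‖ = √Real.pi * (1 / (2 * Real.pi) * ‖r (p₁ + t ^ (-ε))‖) := by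
        rw [norm_coeffH]
        nth_rewrite 3 [← Real.mul_self_sqrt Real.pi_pos.le]
        field_simp
    _ ≤ _ := by gcongr

/-- The phase of `H` oscillates, so only the modulus converges. Continuity of `r` at `p₁` is
one-sided, and `p₁ + t^(-ε)` lies in the band past the threshold. -/
theorem tendsto_norm_coeffH {p₁ p₂ ε : ℝ} {r : ℝ → ℂ} (hε : 0 < ε) (hp : p₁ < p₂)
    (hr : ContinuousOn r (Icc p₁ p₂)) :
    Tendsto (fun t => ‖coeffH ε p₁ r t‖) atTop (𝓝 (1 / (2 * √Real.pi) * ‖r p₁‖)) := by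
  simp only [norm_coeffH]
  refine Tendsto.const_mul _ (Tendsto.norm ?_)
  have h0 : Tendsto (fun t : ℝ => p₁ + t ^ (-ε)) atTop (𝓝 p₁) := by
    simpa using (tendsto_rpow_neg_atTop hε).const_add p₁
  refine (hr p₁ (left_mem_Icc.2 hp.le)).tendsto.comp (tendsto_nhdsWithin_iff.2 ⟨h0, ?_⟩)
  filter_upwards [eventually_gt_atTop 0, eventually_gt_atTop (threshold ε p₁ p₂)] with t ht ht'
  have h1 := Real.rpow_pos_of_pos ht (-ε)
  have h2 := rpow_neg_lt_of_threshold_lt hε hp ht'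
  exact ⟨by linarith, by linarith⟩

/-! ### Optimality -/

/-- A rate is attained if the solution has an expansion on the curve whose leading coefficient is
bounded away from zero. -/
theorem rateAttained_of_expansion {ε p₁ p₂ e c : ℝ} {u m : ℝ → ℝ → ℂ} {n : ℕ} {C a : Fin n → ℝ}
    (hε : 0 < ε) (hp : p₁ < p₂) (hc : 0 < c)
    (hexp : ∀ t x, (t, x) ∈ curve ε p₁ → threshold ε p₁ p₂ < t →
      ‖u t x - m t x * ((t ^ e : ℝ) : ℂ)‖ ≤ ∑ k, C k * t ^ a k)
    (ha : ∀ k, a k < e) (hm : ∀ᶠ t in atTop, ∀ x, c ≤ ‖m t x‖) : RateAttained ε p₁ p₂ u e := by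
  -- Relative to `t^e` the remainder tends to zero, so eventually it costs at most half of `c`.
  have hlim : Tendsto (fun t : ℝ => ∑ k, C k * t ^ (-(e - a k))) atTop (𝓝 0) := by
    have := tendsto_finsetSum Finset.univ fun k (_ : k ∈ Finset.univ) =>
      (tendsto_rpow_neg_atTop (sub_pos.2 (ha k))).const_mul (C k)
    simpa using this
  obtain ⟨T, hT⟩ := eventually_atTop.1 (((hlim.eventually_lt_const (half_pos hc)).and hm).and
    (eventually_gt_atTop (threshold ε p₁ p₂)))
  refine ⟨c / 2, half_pos hc, T, fun t x hx ht => ?_⟩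
  obtain ⟨⟨h1, h2⟩, h3⟩ := hT t ht.le
  have ht0 : 0 < t := hx.1
  refine ⟨mem_region_of_mem_curve hε hp hx h3, ?_⟩
  have hte : 0 < t ^ e := Real.rpow_pos_of_pos ht0 _
  have hsum : ∑ k, C k * t ^ a k = (∑ k, C k * t ^ (-(e - a k))) * t ^ e := by
    rw [Finset.sum_mul]
    refine Finset.sum_congr rfl fun k _ => ?_
    rw [mul_assoc, ← Real.rpow_add ht0]
    congr 2
    ring
  have h4 := hexp t x hx h3
  have h5 : ‖m t x * ((t ^ e : ℝ) : ℂ)‖ = ‖m t x‖ * t ^ e := by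
    rw [norm_mul, Complex.norm_real, Real.norm_of_nonneg hte.le]
  have h6 := norm_sub_norm_le (m t x * ((t ^ e : ℝ) : ℂ)) (u t x)
  rw [norm_sub_rev, h5] at h6
  have h7 : (∑ k, C k * t ^ (-(e - a k))) * t ^ e ≤ c / 2 * t ^ e := by gcongr
  have h8 : c * t ^ e ≤ ‖m t x‖ * t ^ e := by gcongr; exact h2 x
  linarith

/-! ### The three regimes -/

section Regimes

variable {p₁ p₂ μ ε δ : ℝ} {u₀ : 𝓢'(ℝ, ℂ)} {r : ℝ → ℂ} {u : ℝ → ℝ → ℂ}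

theorem constGt_nonneg (hu₀ : InitialCondition p₁ p₂ μ u₀ r) (hδ1 : δ < 1) (k : Fin 9) :
    0 ≤ constGt p₁ p₂ μ δ r k := by
  refine Fin.cases ?_ (fun k => ?_) k
  · have := Real.Gamma_pos_of_pos hu₀.mu_mem.1
    have := supNorm_nonneg p₁ p₂ (scaled r)
    change 0 ≤ Real.Gamma μ / 2 ^ μ * supNorm p₁ p₂ (scaled r)
    positivity
  · exact constCommon_nonneg hu₀.mu_mem.1 hu₀.mu_mem.2 hδ1 hu₀.lt _ k

theorem constLt_nonneg (hu₀ : InitialCondition p₁ p₂ μ u₀ r) (hδ1 : δ < 1) (k : Fin 9) :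
    0 ≤ constLt p₁ p₂ μ δ r k := by
  refine Fin.cases ?_ (fun k => ?_) k
  · have := supNorm_nonneg p₁ p₂ (scaled r)
    change 0 ≤ √Real.pi * supNorm p₁ p₂ (scaled r)
    positivity
  · exact constCommon_nonneg hu₀.mu_mem.1 hu₀.mu_mem.2 hδ1 hu₀.lt _ k

theorem exponent_gt_lt (hμ : 1 / 2 < μ) (hε : 0 < ε) (hε1 : ε < 1 / 2) (hδ : 1 / 2 + ε < δ)
    (k : Fin 9) : -betaGt μ δ k + ε * alphaGt μ δ k < -(1 / 2) + ε * (1 - μ) := by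
  refine Fin.cases ?_ (fun k => ?_) k
  · change -μ + ε * μ < _
    nlinarith
  · exact exponent_common_lt hε hε1 hδ k

theorem exponent_lt_lt (hμ : μ < 1 / 2) (hε : 0 < ε) (hε1 : ε < 1 / 2) (hδ : 1 / 2 + ε < δ)
    (k : Fin 9) : -betaLt δ k + ε * alphaLt μ δ k < -μ + ε * μ := by
  -- The difference of the two sides is `(1 - 2ε)(1/2 - μ)`.
  have h : -(1 / 2) + ε * (1 - μ) < -μ + ε * μ := by nlinarith
  refine Fin.cases ?_ (fun k => ?_) k
  · exact h
  · exact (exponent_common_lt hε hε1 hδ k).trans h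

theorem norm_sub_coeffH_le (hu₀ : InitialCondition p₁ p₂ μ u₀ r) (hu : IsSolution u₀ u)
    (hε : 0 < ε) (hδ : 1 / 2 + ε < δ) (hδ1 : δ < 1) {t x : ℝ} (hx : (t, x) ∈ curve ε p₁)
    (ht : threshold ε p₁ p₂ < t) :
    ‖u t x - coeffH ε p₁ r t * ((t ^ (-(1 / 2) + ε * (1 - μ)) : ℝ) : ℂ)‖
      ≤ ∑ k, constGt p₁ p₂ μ δ r k * t ^ (-betaGt μ δ k + ε * alphaGt μ δ k) := by
  have h := norm_sub_leading_le hu₀ hu hε hδ hδ1 hx ht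
  have hK : ‖coeffK p₁ μ r t x * ((t ^ (-μ + ε * μ) : ℝ) : ℂ)‖
      ≤ Real.Gamma μ / 2 ^ μ * supNorm p₁ p₂ (scaled r) * t ^ (-μ + ε * μ) := by
    have hpos := Real.rpow_pos_of_pos hx.1 (-μ + ε * μ)
    rw [norm_mul, Complex.norm_real, Real.norm_of_nonneg hpos.le]
    exact mul_le_mul_of_nonneg_right
      (norm_coeffK_le hu₀.mu_mem.1 hu₀.lt hu₀.contDiffOn.continuousOn t x) hpos.le
  rw [Fin.sum_univ_succ]
  exact (norm_le_norm_sub_add _ _).trans ((add_comm _ _).trans_le (add_le_add hK h))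

theorem norm_sub_coeffK_le (hu₀ : InitialCondition p₁ p₂ μ u₀ r) (hu : IsSolution u₀ u)
    (hε : 0 < ε) (hδ : 1 / 2 + ε < δ) (hδ1 : δ < 1) {t x : ℝ} (hx : (t, x) ∈ curve ε p₁)
    (ht : threshold ε p₁ p₂ < t) :
    ‖u t x - coeffK p₁ μ r t x * ((t ^ (-μ + ε * μ) : ℝ) : ℂ)‖
      ≤ ∑ k, constLt p₁ p₂ μ δ r k * t ^ (-betaLt δ k + ε * alphaLt μ δ k) := by
  have h := norm_sub_leading_le hu₀ hu hε hδ hδ1 hx ht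
  have hH : ‖coeffH ε p₁ r t * ((t ^ (-(1 / 2) + ε * (1 - μ)) : ℝ) : ℂ)‖
      ≤ √Real.pi * supNorm p₁ p₂ (scaled r) * t ^ (-(1 / 2) + ε * (1 - μ)) := by
    have hpos := Real.rpow_pos_of_pos hx.1 (-(1 / 2) + ε * (1 - μ))
    have h1 := Real.rpow_pos_of_pos hx.1 (-ε)
    have h2 := rpow_neg_lt_of_threshold_lt hε hu₀.lt ht
    rw [norm_mul, Complex.norm_real, Real.norm_of_nonneg hpos.le]
    exact mul_le_mul_of_nonneg_right
      (norm_coeffH_le hu₀.contDiffOn.continuousOn ⟨by linarith, by linarith⟩) hpos.le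
  rw [sub_right_comm] at h
  rw [Fin.sum_univ_succ]
  exact (norm_le_norm_sub_add _ _).trans ((add_comm _ _).trans_le (add_le_add hH h))

theorem norm_sub_coeffK_add_coeffH_le (hu₀ : InitialCondition p₁ p₂ μ u₀ r)
    (hu : IsSolution u₀ u) (hμ : μ = 1 / 2) (hε : 0 < ε) (hδ : 1 / 2 + ε < δ) (hδ1 : δ < 1)
    {t x : ℝ} (hx : (t, x) ∈ curve ε p₁) (ht : threshold ε p₁ p₂ < t) :
    ‖u t x - (coeffK p₁ μ r t x + coeffH ε p₁ r t) * ((t ^ (-(1 / 2) + ε / 2) : ℝ) : ℂ)‖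
      ≤ ∑ k, constEq p₁ p₂ μ δ r k * t ^ (-betaEq δ k + ε * alphaEq μ δ k) := by
  have h := norm_sub_leading_le hu₀ hu hε hδ hδ1 hx ht
  rw [show -(1 / 2) + ε * (1 - μ) = -(1 / 2) + ε / 2 by rw [hμ]; ring,
    show -μ + ε * μ = -(1 / 2) + ε / 2 by rw [hμ]; ring] at h
  rw [add_mul, add_comm, ← sub_sub]
  exact h

theorem exponent_eq_lt (hμ : μ = 1 / 2) (hε : 0 < ε) (hε1 : ε < 1 / 2) (hδ : 1 / 2 + ε < δ)
    (k : Fin 8) : -betaEq δ k + ε * alphaEq μ δ k < -(1 / 2) + ε / 2 := by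
  have h := exponent_common_lt (μ := μ) hε hε1 hδ k
  rwa [show -(1 / 2) + ε * (1 - μ) = -(1 / 2) + ε / 2 by rw [hμ]; ring] at h

theorem eventually_le_norm_coeffH (hu₀ : InitialCondition p₁ p₂ μ u₀ r) (hε : 0 < ε) {c : ℝ}
    (hc : c < 1 / (2 * √Real.pi) * ‖r p₁‖) : ∀ᶠ t in atTop, c ≤ ‖coeffH ε p₁ r t‖ :=
  ((tendsto_norm_coeffH hε hu₀.lt hu₀.contDiffOn.continuousOn).eventually_const_lt hc).mono
    fun _ h => h.le

/-- For `μ = 1 / 2` the two leading terms do not cancel. -/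
theorem norm_coeffK_half_lt (hr : r p₁ ≠ 0) (t x : ℝ) :
    ‖coeffK p₁ (1 / 2) r t x‖ < 1 / (2 * √Real.pi) * ‖r p₁‖ := by
  have hpi := Real.sqrt_pos.2 Real.pi_pos
  have hr' := norm_pos_iff.2 hr
  have h2 : (1 : ℝ) < 2 ^ (1 / 2 : ℝ) := Real.one_lt_rpow one_lt_two (by norm_num)
  rw [norm_coeffK (by norm_num), Real.Gamma_one_half_eq]
  gcongr
  calc 1 / (2 * Real.pi) * (√Real.pi / 2 ^ (1 / 2 : ℝ)) = 1 / (2 * √Real.pi) / 2 ^ (1 / 2 : ℝ) := by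
        nth_rewrite 1 [← Real.mul_self_sqrt Real.pi_pos.le]
        field_simp
    _ < 1 / (2 * √Real.pi) := div_lt_self (by positivity) h2

end Regimes

end SchrodingerBand

theorem theorem4p8 (p₁ p₂ μ ε : ℝ) (u₀ : 𝓢'(ℝ, ℂ)) (r : ℝ → ℂ)
    (hu₀ : InitialCondition p₁ p₂ μ u₀ r) (hε : ε ∈ Ioo (0 : ℝ) (1 / 2)) :
    (∃ u : ℝ → ℝ → ℂ, IsSolution u₀ u) ∧
    ∀ u : ℝ → ℝ → ℂ, IsSolution u₀ u →
      (∀ δ : ℝ, 1 / 2 + ε < δ → μ < δ → δ < 1 →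
        (1 / 2 < μ →
          (∀ k, 0 ≤ constGt p₁ p₂ μ δ r k) ∧
          (∀ k, -betaGt μ δ k + ε * alphaGt μ δ k < -(1 / 2) + ε * (1 - μ)) ∧
          ∀ t x : ℝ, (t, x) ∈ curve ε p₁ → threshold ε p₁ p₂ < t →
            ‖u t x - coeffH ε p₁ r t * ((t ^ (-(1 / 2) + ε * (1 - μ)) : ℝ) : ℂ)‖
              ≤ ∑ k, constGt p₁ p₂ μ δ r k * t ^ (-betaGt μ δ k + ε * alphaGt μ δ k)) ∧
        (μ = 1 / 2 →
          (∀ k, 0 ≤ constEq p₁ p₂ μ δ r k) ∧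
          (∀ k, -betaEq δ k + ε * alphaEq μ δ k < -(1 / 2) + ε / 2) ∧
          ∀ t x : ℝ, (t, x) ∈ curve ε p₁ → threshold ε p₁ p₂ < t →
            ‖u t x - (coeffK p₁ μ r t x + coeffH ε p₁ r t)
                * ((t ^ (-(1 / 2) + ε / 2) : ℝ) : ℂ)‖
              ≤ ∑ k, constEq p₁ p₂ μ δ r k * t ^ (-betaEq δ k + ε * alphaEq μ δ k)) ∧
        (μ < 1 / 2 →
          (∀ k, 0 ≤ constLt p₁ p₂ μ δ r k) ∧
          (∀ k, -betaLt δ k + ε * alphaLt μ δ k < -μ + ε * μ) ∧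
          ∀ t x : ℝ, (t, x) ∈ curve ε p₁ → threshold ε p₁ p₂ < t →
            ‖u t x - coeffK p₁ μ r t x * ((t ^ (-μ + ε * μ) : ℝ) : ℂ)‖
              ≤ ∑ k, constLt p₁ p₂ μ δ r k * t ^ (-betaLt δ k + ε * alphaLt μ δ k))) ∧
      (1 / 2 < μ → RateAttained ε p₁ p₂ u (-(1 / 2) + ε * (1 - μ))) ∧
      (μ = 1 / 2 → RateAttained ε p₁ p₂ u (-(1 / 2) + ε / 2)) ∧
      (μ < 1 / 2 → RateAttained ε p₁ p₂ u (-μ + ε * μ)) := by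
  obtain ⟨hε0, hε1⟩ := hε
  have hμ0 := hu₀.mu_mem.1
  have hμ1 := hu₀.mu_mem.2
  have hp := hu₀.lt
  have hr0 : 0 < ‖r p₁‖ := norm_pos_iff.2 hu₀.left_ne_zero
  have hpi := Real.sqrt_pos.2 Real.pi_pos
  have hH : 0 < 1 / (2 * √Real.pi) * ‖r p₁‖ := by positivity
  refine ⟨⟨_, hu₀.isSolution_wavePacket⟩, fun u hu => ⟨fun δ hδ _ hδ1 => ⟨fun hμ => ⟨?_, ?_, ?_⟩,
    fun hμ => ⟨?_, ?_, ?_⟩, fun hμ => ⟨?_, ?_, ?_⟩⟩, ?_, ?_, ?_⟩⟩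
  · exact constGt_nonneg hu₀ hδ1
  · exact exponent_gt_lt hμ hε0 hε1 hδ
  · exact fun t x => norm_sub_coeffH_le hu₀ hu hε0 hδ hδ1
  · exact constCommon_nonneg hμ0 hμ1 hδ1 hp _
  · exact exponent_eq_lt hμ hε0 hε1 hδ
  · exact fun t x => norm_sub_coeffK_add_coeffH_le hu₀ hu hμ hε0 hδ hδ1
  · exact constLt_nonneg hu₀ hδ1
  · exact exponent_lt_lt hμ hε0 hε1 hδ
  · exact fun t x => norm_sub_coeffK_le hu₀ hu hε0 hδ hδ1
  -- The rates do not involve `δ`, so any `δ` in `(1/2 + ε, 1)` serves; the interval is nonempty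
  -- because `ε < 1/2`.
  all_goals
    intro hμ
    obtain ⟨δ, hδ, hδ1⟩ := exists_between (show 1 / 2 + ε < 1 by linarith)
  · exact rateAttained_of_expansion hε0 hp (half_pos hH)
      (m := fun t _ => coeffH ε p₁ r t)
      (fun t x => norm_sub_coeffH_le hu₀ hu hε0 hδ hδ1) (exponent_gt_lt hμ hε0 hε1 hδ)
      ((eventually_le_norm_coeffH hu₀ hε0 (half_lt_self hH)).mono fun _ h _ => h)
  · have hlt : ‖coeffK p₁ μ r 0 0‖ < 1 / (2 * √Real.pi) * ‖r p₁‖ := by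
      rw [hμ]
      exact norm_coeffK_half_lt hu₀.left_ne_zero 0 0
    obtain ⟨c, hc, hc1⟩ := exists_between hlt
    refine rateAttained_of_expansion hε0 hp (sub_pos.2 hc)
      (m := fun t x => coeffK p₁ μ r t x + coeffH ε p₁ r t)
      (fun t x => norm_sub_coeffK_add_coeffH_le hu₀ hu hμ hε0 hδ hδ1)
      (exponent_eq_lt hμ hε0 hε1 hδ)
      ((eventually_le_norm_coeffH hu₀ hε0 hc1).mono fun t h x => ?_)
    have h1 : ‖coeffK p₁ μ r t x‖ = ‖coeffK p₁ μ r 0 0‖ := by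
      rw [norm_coeffK hμ0, norm_coeffK hμ0]
    have h2 := norm_sub_le_norm_add (coeffH ε p₁ r t) (coeffK p₁ μ r t x)
    rw [add_comm (coeffK p₁ μ r t x)]
    linarith
  · have hK : 0 < 1 / (2 * Real.pi) * (Real.Gamma μ / 2 ^ μ) * ‖r p₁‖ := by
      have := Real.Gamma_pos_of_pos hμ0
      have := Real.pi_pos
      positivity
    exact rateAttained_of_expansion hε0 hp hK (m := fun t x => coeffK p₁ μ r t x)
      (fun t x => norm_sub_coeffK_le hu₀ hu hε0 hδ hδ1) (exponent_lt_lt hμ hε0 hε1 hδ)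
      (Filter.Eventually.of_forall fun t x => (norm_coeffK hμ0 p₁ r t x).ge)
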